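/- **Setting.** Let $A>0$. The Poisson channel $P$ under peak power constraint $A$ has inputs $x\in[0,A]$ and outputs $Y\sim\mathrm{Pois}(x)$ on $\{0,1,2,\dots\}$; it is memoryless, so on input $u\in[0,A]^n$ the output law $P^n(\cdot\,|u)$ is $\bigotimes_{t=1}^n\mathrm{Pois}(u_t)$. For $\lambda_1,\lambda_2>0$, an $(n,N,\lambda_1,\lambda_2)$ deterministic identification (DI) code is a family of $N$ pairs $(u_i,\mathcal D_i)$ with $u_i\in[0,A]^n$ and $\mathcal D_i\subset\{0,1,2,\dots\}^n$ such that $P^n(\mathcal D_i|u_i)\ge 1-\lambda_1$ for all $i$ and $P^n(\mathcal D_j|u_i)\le\lambda_2$ for all $i\ne j$. A number $\dot R>0$ is an achievable linearithmic rate if there are $(n,N^{(n)},\lambda_1^{(n)},\lambda_2^{(n)})$ DI codes, $n\ge 1$, with $\lambda_1^{(n)},\lambda_2^{(n)}\to0$ and $\frac{\log N^{(n)}}{n\log n}\to\dot R$; we say that these codes achieve $\dot R$. The DI capacity $\dot C_{\mathrm{DI}}(P)$ is the largest achievable linearithmic rate. Logarithms are natural. *The code.* For $v\neq 0$ let $\Pi_v$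 be the orthogonal projection of $\mathbb R^n$ onto $\mathrm{span}(v)$. Let $L\ge1$ and $0<\delta<1$. A primitive $L$-layer code book scaled by $A$ consists of sizes $N_1,\dots,N_L$ and points $o_{s_1\dots s_\ell}\in\mathbb R^n$ ($0\le\ell\le L$, $1\le s_k\le N_k$) such that the layer-$0$ point is $(A/2,\dots,A/2)$; along each string $s=(s_1,\dots,s_L)$ the displacements $v_\ell(s)=o_{s_1\dots s_\ell}-o_{s_1\dots s_{\ell-1}}$ are mutually orthogonal, with $\|v_\ell(s)\|=r_\ell:=A\,n^{(1-\delta)/2^\ell}$; and for each fixed prefix $s_1\dots s_{\ell-1}$ the displacements $w_a$ from $o_{s_1\dots s_{\ell-1}}$ to $o_{s_1\dots s_{\ell-1}a}$ ($1\le a\le N_\ell$) satisfy $\|\Pi_{w_b}w_a-w_b\|\ge 3A\log n$ for all $a\ne b$. The messages are the strings $s$ with $o_s:=o_{s_1\dots s_L}\in[0,A]^n$; message $s$ has code word $o_s$ and decoder of radius $A\log n$, $$\mathcal D_s=\bigl\{y\in\{0,1,2,\dots\}^n:\ \|\Pi_{v_\ell(s)}(y-o_{s_1\dots s_\ell})\|\le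 A\log n\ \text{ for all }1\le\ell\le L\bigr\}.$$ **Theorem.** Let $\lambda=\lambda_n=\exp\bigl[\tfrac{3A}{2}\bigl(\tfrac32-\log n\bigr)\bigr]$. 1. For every fixed $L\ge1$ there are $(n,N^{(n)},L\lambda_n,\lambda_n)$ DI codes over $P$, $n\ge1$, that achieve the linearithmic rate $\tfrac12$. 2. For all fixed $L\ge1$ and $0<\delta<1$, and all sufficiently large $n$: for every primitive $L$-layer code book scaled by $A$, the code above is an $(n,N,L\lambda,\lambda)$ DI code over $P$, $N$ being its number of messages; moreover the code book can be chosen so that $$\log N\ \ge\ \frac{n\log n}{2}\sum_{\ell=1}^L\frac{1-\delta}{2^\ell}-O(n\log\log n),$$ where the constant in $O(\cdot)$ does not depend on $n$. 3. Hence this construction comes arbitrarily close to the rate $\tfrac12$: for every $\varepsilon>0$ there are fixed $L\ge 1$ and $0<\delta<1$ such that, for all sufficiently large $n$, the code book can be chosen with $\frac{\log N}{n\log n}\ge\tfrac12-\varepsilon$. 4. $\dot C_{\mathrm{DI}}(P)=\tfrac12$. -/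

import Mathlib

open MeasureTheory ProbabilityTheory Filter Topology

noncomputable section

/-! ### Deterministic identification (DI) over memoryless channels -/

/-- The output law `Wⁿ(· | x)` of `n` memoryless uses of the channel `W` on the input word `x`. -/
def blockLaw {X Y : Type*} [MeasurableSpace Y] {n : ℕ} (W : X → ProbabilityMeasure Y)
    (x : Fin n → X) : Measure (Fin n → Y) :=
  Measure.pi fun t => (W (x t) : Measure Y)

/-- The pairs `(u i, D i)` of input words and (measurable) decoding regions form a DI code of block
length `n` with errors of the first and second kind at most `l₁`, `l₂`; messages are indexed
by `ι`, so the number of messages is the cardinality of `ι`. -/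
structure IsDICode {X Y ι : Type*} [MeasurableSpace Y] {n : ℕ} (W : X → ProbabilityMeasure Y)
    (u : ι → Fin n → X) (D : ι → Set (Fin n → Y)) (l₁ l₂ : ℝ) : Prop where
  pos₁ : 0 < l₁
  pos₂ : 0 < l₂
  measurable : ∀ i, MeasurableSet (D i)
  missed : ∀ i, 1 - l₁ ≤ (blockLaw W (u i)).real (D i)
  false_id : ∀ i j, i ≠ j → (blockLaw W (u i)).real (D j) ≤ l₂

/-- There is an `(n, N, l₁, l₂)` DI code over `W`. -/
def ExistsDICode {X Y : Type*} [MeasurableSpace Y] (W : X → ProbabilityMeasure Y)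
    (n N : ℕ) (l₁ l₂ : ℝ) : Prop :=
  ∃ (u : Fin N → Fin n → X) (D : Fin N → Set (Fin n → Y)), IsDICode W u D l₁ l₂

/-- There is a reliable sequence of `(n, N n, l₁ n, l₂ n)` DI codes over `W` (one for every block
length `n ≥ 1`, with both errors vanishing) whose linearithmic rate
`log (N n) / (n log n)` converges to `R`. -/
structure AchievesRate {X Y : Type*} [MeasurableSpace Y] (W : X → ProbabilityMeasure Y)
    (N : ℕ → ℕ) (l₁ l₂ : ℕ → ℝ) (R : ℝ) : Prop where
  codes : ∀ n, 1 ≤ n → ExistsDICode W n (N n) (l₁ n) (l₂ n)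
  tendsto₁ : Tendsto l₁ atTop (𝓝 0)
  tendsto₂ : Tendsto l₂ atTop (𝓝 0)
  rate : Tendsto (fun n : ℕ => Real.log (N n) / (n * Real.log n)) atTop (𝓝 R)

/-- `R > 0` is an achievable linearithmic DI rate of `W`. -/
def IsAchievableRate {X Y : Type*} [MeasurableSpace Y] (W : X → ProbabilityMeasure Y)
    (R : ℝ) : Prop :=
  0 < R ∧ ∃ (N : ℕ → ℕ) (l₁ l₂ : ℕ → ℝ), AchievesRate W N l₁ l₂ R

/-- The linearithmic DI capacity of `W`, the largest achievable linearithmic rate, equals `C`. -/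
def HasDICapacity {X Y : Type*} [MeasurableSpace Y] (W : X → ProbabilityMeasure Y)
    (C : ℝ) : Prop :=
  IsGreatest {R : ℝ | IsAchievableRate W R} C

/-- The Poisson channel under the peak power constraint `A`: inputs `x ∈ [0, A]`, and the output is
a Poisson variable of mean `x`. -/
def poissonChannel (A : ℝ) : Set.Icc (0 : ℝ) A → ProbabilityMeasure ℕ :=
  fun x => ⟨poissonMeasure (x : ℝ).toNNReal, inferInstance⟩

/-! ### The multi-layer geometric code -/

/-- The orthogonal projection `Π_v x` of `x` onto `span {v}`. -/
def projOnto {n : ℕ} (v x : EuclideanSpace ℝ (Fin n)) : EuclideanSpace ℝ (Fin n) :=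
  (Submodule.span ℝ {v}).starProjection x

/-- The vectors `p a` lie on the sphere of radius `r` about the origin and form a `d`-angle-dense
arrangement: `‖Π_{p b} (p a) - p b‖ ≥ d` for distinct indices. -/
def IsAngleDense {n : ℕ} {ι : Type*} (d r : ℝ) (p : ι → EuclideanSpace ℝ (Fin n)) : Prop :=
  (∀ a, ‖p a‖ = r) ∧ ∀ a b, a ≠ b → d ≤ ‖projOnto (p b) (p a) - p b‖

/-- A primitive code book with `L` layers in `ℝⁿ`, centre `c`, layer radii `r` (the `ℓ`-th layer,
`ℓ = 1, …, L`, has radius `r (ℓ - 1)`) and minimum projective distance `d`.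

Points are addressed by strings `s = (s₁, …, s_L)`, and `point s ℓ` is the layer-`ℓ` point
`o_{s₁ … s_ℓ}`. It depends only on the first `ℓ` letters of `s` and the layer-`0` point is `c`.
The displacements from one layer to the next along any string are mutually orthogonal, and the
displacements from any point to its children in the next layer are a `d`-angle-dense
arrangement of the prescribed radius. -/
structure PrimitiveCodebook (n L : ℕ) (c : EuclideanSpace ℝ (Fin n)) (r : Fin L → ℝ) (d : ℝ) where
  /-- number of children of each point of the preceding layer -/
  size : Fin L → ℕ
  /-- the points of all layers -/
  point : (∀ ℓ : Fin L, Fin (size ℓ)) → Fin (L + 1) → EuclideanSpace ℝ (Fin n)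
  point_zero : ∀ s, point s 0 = c
  point_congr : ∀ (s s' : ∀ ℓ : Fin L, Fin (size ℓ)) (m : Fin (L + 1)),
    (∀ k : Fin L, k.val < m.val → s k = s' k) → point s m = point s' m
  orthogonal : ∀ (s : ∀ ℓ : Fin L, Fin (size ℓ)) (k ℓ : Fin L), k ≠ ℓ →
    inner ℝ (point s k.succ - point s k.castSucc) (point s ℓ.succ - point s ℓ.castSucc) = 0
  angleDense : ∀ (s : ∀ ℓ : Fin L, Fin (size ℓ)) (ℓ : Fin L),
    IsAngleDense d (r ℓ) fun a : Fin (size ℓ) =>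
      point (Function.update s ℓ a) ℓ.succ - point (Function.update s ℓ a) ℓ.castSucc

namespace PrimitiveCodebook

variable {n L : ℕ} {c : EuclideanSpace ℝ (Fin n)} {r : Fin L → ℝ} {d : ℝ}

/-- The strings `s` that address the primitive code words. -/
abbrev Address (B : PrimitiveCodebook n L c r d) : Type := ∀ ℓ : Fin L, Fin (B.size ℓ)

/-- The primitive code word addressed by `s`: its point in the innermost layer. -/
def word (B : PrimitiveCodebook n L c r d) (s : B.Address) : EuclideanSpace ℝ (Fin n) :=
  B.point s (Fin.last L)

/-- The displacement of `s` from layer `ℓ` to the next layer. -/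
def disp (B : PrimitiveCodebook n L c r d) (s : B.Address) (ℓ : Fin L) :
    EuclideanSpace ℝ (Fin n) :=
  B.point s ℓ.succ - B.point s ℓ.castSucc

/-- The messages that remain after expurgation: primitive code words in the cube `[0, A]ⁿ`. -/
abbrev Message (B : PrimitiveCodebook n L c r d) (A : ℝ) : Type :=
  {s : B.Address // ∀ t, B.word s t ∈ Set.Icc (0 : ℝ) A}

/-- The code word of a message, as an admissible channel input. -/
def input (B : PrimitiveCodebook n L c r d) (A : ℝ) (s : B.Message A) : Fin n → Set.Icc (0 : ℝ) A :=
  fun t => ⟨B.word s.1 t, s.2 t⟩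

/-- The sequential decoder of radius `ρ`: in every layer, the component of the output `y` along the
direction of that layer's displacement is within `ρ` of the layer's point. (Projecting `y` onto
the line through the centre of the arrangement in the direction of the displacement and
subtracting the layer's point gives `Π (y - o)`.) -/
def decoder (B : PrimitiveCodebook n L c r d) (ρ : ℝ) (s : B.Address) : Set (Fin n → ℕ) :=
  {y | ∀ ℓ : Fin L,
    ‖projOnto (B.disp s ℓ) (WithLp.toLp 2 (fun t => (y t : ℝ)) - B.point s ℓ.succ)‖ ≤ ρ}

end PrimitiveCodebook

/-- The primitive code books for the Bernoulli channel scaled by `A`: centre `(A/2, …, A/2)`, radii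
`A n^((1-δ)/2^ℓ)` for `ℓ = 1, …, L`, minimum projective distance `3 A log n`. -/
abbrev PoissonCodebook (A δ : ℝ) (L n : ℕ) : Type :=
  PrimitiveCodebook n L (WithLp.toLp 2 fun _ => A / 2)
    (fun ℓ => A * (n : ℝ) ^ ((1 - δ) / 2 ^ (ℓ.val + 1))) (3 * A * Real.log n)

/-- The error bound `exp[(3A/2)(3/2 - log n)]`. -/
def poissonError (A : ℝ) (n : ℕ) : ℝ :=
  Real.exp (3 * A / 2 * (3 / 2 - Real.log n))

end

noncomputable section

/-! ### Products of Poisson laws -/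

/-! Converse. For mean vectors `u`, `w` with Poisson laws `P`, `Q`, let `G` be the Poisson law with
means `√(u t) * √(w t)`. Pointwise `G² = exp(∑ (√u - √w)²) P Q`. If the exponent is at most `1`,
AM-GM bounds `G` by a combination of `P` and `Q`, pointwise and hence on every set. This prevents a
decoder from separating `u` from `w` with small errors. So the square roots of code words are more
than distance `1` apart (`one_lt_sum_sq_of_isDICode`), and a grid of mesh `1/√n` counts at most
about `(√(A n))^n` of them: rate at most `1/2`.

Errors of the code. A unit-norm linear statistic of the output deviates by `A log n` with
probability `O(n^(-2A))`, below the claimed `n^(-3A/2)` scale (`poissonProd_tail`). Along a word's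
own displacement the later layers are invisible, by orthogonality, so only noise is seen. For two
words that first split in layer `ℓ`, the angular gap shifts the statistic by at least `3A log n`.
The later layers of the sent word can undo at most a third of this, because their radii are at most
`√(A r_ℓ)` (`le_abs_inner_word_sub_point`).

Size of the code. Directions are integer vectors from a box of side about `n^(β/2)/log n` for a
layer of radius `A n^β`. Pigeonholing on inner products with the earlier directions and on the
squared norm costs only polynomial factors; a Gilbert-Varshamov choice then forces differences in
about `n/log n` coordinates (`exists_separated_orthogonal`). Each layer contributes `(β/2) n log n -
O(n log log n)` to `log N`, and the exponents `β = (1-δ)/2^ℓ` sum to nearly `1`. -/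

lemma measureReal_le_of_singleton {α : Type*} [MeasurableSpace α] [Countable α]
    [MeasurableSingletonClass α] (R P Q : Measure α) [IsFiniteMeasure R] [IsFiniteMeasure P]
    [IsFiniteMeasure Q] (a b : NNReal) (D : Set α)
    (h : ∀ y ∈ D, R.real {y} ≤ a * P.real {y} + b * Q.real {y}) :
    R.real D ≤ a * P.real D + b * Q.real D := by
  have hD : MeasurableSet D := D.to_countable.measurableSet
  have hν : ∀ s : Set α, (a • P + b • Q).real s = a * P.real s + b * Q.real s := by
    intro s
    rw [measureReal_add_apply]
    simp [measureReal_nnreal_smul_apply]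
  rw [← hν]
  simp only [← hν] at h
  refine ENNReal.toReal_mono (measure_ne_top _ _) ?_
  rw [← Measure.tsum_indicator_apply_singleton R D hD,
    ← Measure.tsum_indicator_apply_singleton _ D hD]
  refine ENNReal.tsum_le_tsum fun y => ?_
  by_cases hy : y ∈ D
  · simp only [Set.indicator_of_mem hy]
    exact (ENNReal.toReal_le_toReal (measure_ne_top _ _) (measure_ne_top _ _)).1 (h y hy)
  · simp [Set.indicator_of_notMem hy]

/-- The joint law of independent Poisson variables with means `a t`. -/
def poissonProd {n : ℕ} (a : Fin n → ℝ) : Measure (Fin n → ℕ) :=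
  Measure.pi fun t => poissonMeasure (a t).toNNReal

instance {n : ℕ} (a : Fin n → ℝ) : IsProbabilityMeasure (poissonProd a) := by
  unfold poissonProd; infer_instance

lemma blockLaw_poissonChannel {A : ℝ} {n : ℕ} (u : Fin n → Set.Icc (0 : ℝ) A) :
    blockLaw (poissonChannel A) u = poissonProd fun t => (u t : ℝ) := rfl

lemma poissonProd_real_singleton {n : ℕ} {a : Fin n → ℝ} (ha : ∀ t, 0 ≤ a t) (y : Fin n → ℕ) :
    (poissonProd a).real {y} = ∏ t, (Real.exp (-a t) * a t ^ y t / (y t).factorial) := by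
  rw [Measure.real, poissonProd, Measure.pi_singleton, ENNReal.toReal_prod]
  refine Finset.prod_congr rfl fun t _ => ?_
  have := poissonMeasure_real_singleton (a t).toNNReal (y t)
  rwa [Measure.real, Real.coe_toNNReal _ (ha t)] at this

/-! ### Concentration of linear statistics -/

lemma exp_two_mul_sub_le {x : ℝ} (hx : |x| ≤ 1) :
    Real.exp (2 * x) - 1 - 2 * x ≤ 6 * x ^ 2 := by
  have h := (abs_le.1 (Real.abs_exp_sub_one_sub_id_le hx)).2
  obtain ⟨h1, h2⟩ := abs_le.1 hx
  have h3 : Real.exp (2 * x) = Real.exp x ^ 2 := by rw [← Real.exp_nat_mul]; norm_num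
  have h4 : Real.exp x ^ 2 ≤ (1 + x + x ^ 2) ^ 2 :=
    pow_le_pow_left₀ (Real.exp_pos _).le (by linarith) 2
  have h5 : x ^ 3 ≤ x ^ 2 := by nlinarith [sq_nonneg x]
  have h6 : x ^ 4 ≤ x ^ 2 := by nlinarith [sq_nonneg x, mul_nonneg (sub_nonneg.2 h2) (by linarith : 0 ≤ 1 + x)]
  nlinarith

/-- Exponential tilting by the factor `2`: replacing each mean `u t` by `u t * exp (2 * v t)` gives
another product of Poisson laws, and on the event the density ratio is at most the claimed bound.
Since `v` is a unit vector, `|v t| ≤ 1`, so the second-order term of the exponent is at most `6 A ∑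
v t ^ 2 = 6 A`. -/
lemma poissonProd_upper_tail {n : ℕ} {A : ℝ} {u : Fin n → ℝ} (hA : 0 ≤ A)
    (hu : ∀ t, u t ∈ Set.Icc 0 A)
    {v : Fin n → ℝ} (hv : ∑ t, v t ^ 2 = 1) (τ : ℝ) :
    (poissonProd u).real {y | τ ≤ ∑ t, v t * ((y t : ℝ) - u t)} ≤
      Real.exp (6 * A - 2 * τ) := by
  set u' : Fin n → ℝ := fun t => u t * Real.exp (2 * v t)
  have hu' : ∀ t, 0 ≤ u' t := fun t => mul_nonneg (hu t).1 (Real.exp_pos _).le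
  have key := measureReal_le_of_singleton (poissonProd u) (poissonProd u') (poissonProd u')
    ⟨Real.exp (6 * A - 2 * τ), (Real.exp_pos _).le⟩ 0
    {y | τ ≤ ∑ t, v t * ((y t : ℝ) - u t)} ?_
  · refine key.trans ?_
    simp only [NNReal.coe_zero, zero_mul, add_zero]
    exact mul_le_of_le_one_right (Real.exp_pos _).le measureReal_le_one
  · intro y hy
    simp only [NNReal.coe_zero, zero_mul, add_zero]
    rw [poissonProd_real_singleton (fun t => (hu t).1), poissonProd_real_singleton hu']
    have hterm : ∀ t, Real.exp (-u t) * u t ^ y t / (y t).factorial =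
        Real.exp (u t * (Real.exp (2 * v t) - 1 - 2 * v t) - 2 * (v t * ((y t : ℝ) - u t))) *
          (Real.exp (-u' t) * u' t ^ y t / (y t).factorial) := by
      intro t
      simp only [u', mul_pow, ← Real.exp_nat_mul]
      rw [← mul_div_assoc]
      congr 1
      have : Real.exp (-u t) = Real.exp (u t * (Real.exp (2 * v t) - 1 - 2 * v t) -
          2 * (v t * ((y t : ℝ) - u t))) * Real.exp (-(u t * Real.exp (2 * v t))) *
          Real.exp (y t * (2 * v t)) := by
        rw [← Real.exp_add, ← Real.exp_add]; congr 1; ring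
      rw [this]; ring
    rw [Finset.prod_congr rfl fun t _ => hterm t, Finset.prod_mul_distrib, ← Real.exp_sum]
    refine mul_le_mul_of_nonneg_right (Real.exp_le_exp.2 ?_) (Finset.prod_nonneg fun t _ => ?_)
    · rw [Finset.sum_sub_distrib, ← Finset.mul_sum]
      have h1 : ∑ t, u t * (Real.exp (2 * v t) - 1 - 2 * v t) ≤ ∑ t, A * (6 * v t ^ 2) := by
        refine Finset.sum_le_sum fun t _ => ?_
        have hvt : |v t| ≤ 1 := by
          rw [← sq_le_one_iff_abs_le_one, ← hv]
          exact Finset.single_le_sum (f := fun t => v t ^ 2) (fun i _ => sq_nonneg _)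
            (Finset.mem_univ t)
        have h0 : 0 ≤ Real.exp (2 * v t) - 1 - 2 * v t := by
          linarith [Real.add_one_le_exp (2 * v t)]
        exact mul_le_mul (hu t).2 (exp_two_mul_sub_le hvt) h0 hA
      rw [← Finset.mul_sum, ← Finset.mul_sum, hv] at h1
      have : τ ≤ ∑ t, v t * ((y t : ℝ) - u t) := hy
      linarith
    · have := hu' t
      positivity

lemma poissonProd_tail {n : ℕ} {A : ℝ} {u : Fin n → ℝ} (hA : 0 ≤ A)
    (hu : ∀ t, u t ∈ Set.Icc 0 A)
    {v : Fin n → ℝ} (hv : ∑ t, v t ^ 2 = 1) (τ : ℝ) :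
    (poissonProd u).real {y | τ ≤ |∑ t, v t * ((y t : ℝ) - u t)|} ≤
      2 * Real.exp (6 * A - 2 * τ) := by
  have h1 := poissonProd_upper_tail hA hu hv τ
  have h2 := poissonProd_upper_tail (v := fun t => -v t) hA hu (by simpa using hv) τ
  have h3 : {y : Fin n → ℕ | τ ≤ |∑ t, v t * ((y t : ℝ) - u t)|} ⊆
      {y | τ ≤ ∑ t, v t * ((y t : ℝ) - u t)} ∪ {y | τ ≤ ∑ t, -v t * ((y t : ℝ) - u t)} := by
    intro y hy
    simpa [le_abs, Finset.sum_neg_distrib] using hy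
  calc _ ≤ _ := measureReal_mono h3
    _ ≤ _ := measureReal_union_le _ _
    _ ≤ _ := by linarith

/-! ### The converse -/

/-- The squared mass of the geometric-mean law at a point is at most `e p q ≤ 4 a b p q ≤ (a p + b
q)²`. The free weights let one law be charged heavily where its mass is known to be small. -/
lemma poissonProd_geomMean_le {n : ℕ} {u w : Fin n → ℝ} (hu : ∀ t, 0 ≤ u t) (hw : ∀ t, 0 ≤ w t)
    (huw : ∑ t, (√(u t) - √(w t)) ^ 2 ≤ 1) {a b : NNReal} (hab : Real.exp 1 ≤ 4 * a * b)
    (D : Set (Fin n → ℕ)) :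
    (poissonProd fun t => √(u t) * √(w t)).real D ≤
      a * (poissonProd u).real D + b * (poissonProd w).real D := by
  refine measureReal_le_of_singleton _ _ _ a b D fun y _ => ?_
  rw [poissonProd_real_singleton (fun t => by positivity), poissonProd_real_singleton hu,
    poissonProd_real_singleton hw]
  set p := ∏ t, (Real.exp (-u t) * u t ^ y t / (y t).factorial)
  set q := ∏ t, (Real.exp (-w t) * w t ^ y t / (y t).factorial)
  have hp : 0 ≤ p := Finset.prod_nonneg fun t _ => by have := hu t; positivity
  have hq : 0 ≤ q := Finset.prod_nonneg fun t _ => by have := hw t; positivity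
  refine le_of_sq_le_sq ?_ (by positivity)
  have h1 : (∏ t, (Real.exp (-(√(u t) * √(w t))) * (√(u t) * √(w t)) ^ y t /
      (y t).factorial)) ^ 2 = Real.exp (∑ t, (√(u t) - √(w t)) ^ 2) * (p * q) := by
    rw [Real.exp_sum, ← Finset.prod_mul_distrib, ← Finset.prod_mul_distrib, ← Finset.prod_pow]
    refine Finset.prod_congr rfl fun t _ => ?_
    have e1 : u t = √(u t) ^ 2 := (Real.sq_sqrt (hu t)).symm
    have e2 : w t = √(w t) ^ 2 := (Real.sq_sqrt (hw t)).symm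
    have e3 : Real.exp (-(√(u t) * √(w t))) ^ 2 =
        Real.exp ((√(u t) - √(w t)) ^ 2) * Real.exp (-√(u t) ^ 2) * Real.exp (-√(w t) ^ 2) := by
      rw [← Real.exp_add, ← Real.exp_add, ← Real.exp_nat_mul]; congr 1; push_cast; ring
    conv_rhs => rw [e1, e2]
    simp only [Real.sqrt_sq (Real.sqrt_nonneg _)]
    rw [div_pow, mul_pow, e3]
    field_simp
    ring
  rw [h1]
  have h2 : Real.exp (∑ t, (√(u t) - √(w t)) ^ 2) ≤ 4 * a * b :=
    (Real.exp_le_exp.2 huw).trans hab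
  have h3 := mul_le_mul_of_nonneg_right h2 (mul_nonneg hp hq)
  nlinarith [sq_nonneg ((a : ℝ) * p - b * q)]

lemma one_lt_sum_sq_of_isDICode {A : ℝ} {n : ℕ} {ι : Type*} {u : ι → Fin n → Set.Icc (0 : ℝ) A}
    {D : ι → Set (Fin n → ℕ)} {l₁ l₂ : ℝ} (h : IsDICode (poissonChannel A) u D l₁ l₂)
    (h₁ : l₁ < 1 / 16) (h₂ : l₂ < 1 / 16) {i j : ι} (hij : i ≠ j) :
    1 < ∑ t, (√(u i t : ℝ) - √(u j t : ℝ)) ^ 2 := by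
  by_contra! hc
  -- The weights satisfy `4 · (7/2) · (1/5) = 2.8 > e`. The heavy weight goes to `u i` on `D j` and
  -- to `u j` on the complement, the two small error events. Adding the bounds gives `1 ≤ (7/2)(l₁ +
  -- l₂) + 2/5 < 1`.
  have hexp : Real.exp 1 ≤ 4 * (7 / 2 : NNReal) * (1 / 5 : NNReal) := by
    have := Real.exp_one_lt_d9; push_cast; linarith
  have hexp' : Real.exp 1 ≤ 4 * (1 / 5 : NNReal) * (7 / 2 : NNReal) := by
    have := Real.exp_one_lt_d9; push_cast; linarith
  have k1 := poissonProd_geomMean_le (fun t => (u i t).2.1) (fun t => (u j t).2.1) hc hexp (D j)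
  have k2 := poissonProd_geomMean_le (fun t => (u i t).2.1) (fun t => (u j t).2.1) hc hexp' (D j)ᶜ
  have hm := h.measurable j
  rw [probReal_compl_eq_one_sub hm, probReal_compl_eq_one_sub hm, probReal_compl_eq_one_sub hm]
    at k2
  have m := h.missed j
  have f := h.false_id i j hij
  rw [blockLaw_poissonChannel] at m f
  push_cast at k1 k2
  have b1 : (poissonProd fun t => (u j t : ℝ)).real (D j) ≤ 1 := measureReal_le_one
  have b2 : 0 ≤ (poissonProd fun t => (u i t : ℝ)).real (D j) := measureReal_nonneg
  linarith

/-- Words whose square roots share a cell of side `1/√n` are at squared distance at most `n · (1/n)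
= 1`, so the map from messages to cells is injective. -/
lemma card_le_of_existsDICode {A : ℝ} (hA : 0 < A) {n N : ℕ} (hn : 1 ≤ n) {l₁ l₂ : ℝ}
    (h : ExistsDICode (poissonChannel A) n N l₁ l₂) (h₁ : l₁ < 1 / 16) (h₂ : l₂ < 1 / 16) :
    (N : ℝ) ≤ (√A * √n + 1) ^ n := by
  obtain ⟨u, D, hD⟩ := h
  have hcell : ∀ i t, ⌊√(u i t : ℝ) * √n⌋₊ < ⌊√A * √n⌋₊ + 1 := fun i t =>
    Nat.lt_succ_of_le (Nat.floor_le_floor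
      (mul_le_mul_of_nonneg_right (Real.sqrt_le_sqrt (u i t).2.2) (Real.sqrt_nonneg _)))
  let f : Fin N → Fin n → Fin (⌊√A * √n⌋₊ + 1) := fun i t => ⟨_, hcell i t⟩
  have hf : Function.Injective f := by
    intro i j hij
    by_contra hne
    have h1 := one_lt_sum_sq_of_isDICode hD h₁ h₂ hne
    have hn' : (0 : ℝ) < n := by exact_mod_cast hn
    have h2 : ∑ t, (√(u i t : ℝ) - √(u j t : ℝ)) ^ 2 ≤ ∑ t : Fin n, (1 / n : ℝ) := by
      refine Finset.sum_le_sum fun t _ => ?_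
      have ht : ⌊√(u i t : ℝ) * √n⌋₊ = ⌊√(u j t : ℝ) * √n⌋₊ := by
        simpa [f] using congrFun hij t
      have a1 := Nat.floor_le (show 0 ≤ √(u i t : ℝ) * √n by positivity)
      have a2 := Nat.floor_le (show 0 ≤ √(u j t : ℝ) * √n by positivity)
      have a3 := Nat.lt_floor_add_one (√(u i t : ℝ) * √n)
      have a4 := Nat.lt_floor_add_one (√(u j t : ℝ) * √n)
      rw [ht] at a1 a3
      rw [le_div_iff₀ hn']
      suffices h : ((√(u i t : ℝ) - √(u j t : ℝ)) * √n) ^ 2 ≤ 1 by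
        rwa [mul_pow, Real.sq_sqrt hn'.le] at h
      rw [sq_le_one_iff_abs_le_one, abs_le]
      constructor <;> nlinarith
    simp only [Finset.sum_const, Finset.card_univ, Fintype.card_fin, nsmul_eq_mul] at h2
    rw [mul_one_div_cancel hn'.ne'] at h2
    linarith
  have := Fintype.card_le_of_injective f hf
  simp only [Fintype.card_fin, Fintype.card_fun] at this
  calc (N : ℝ) ≤ ((⌊√A * √n⌋₊ + 1 : ℕ) : ℝ) ^ n := by exact_mod_cast this
    _ ≤ _ := by
      push_cast
      gcongr
      exact Nat.floor_le (by positivity)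

/-! ### Errors of the multi-layer code -/

lemma projOnto_eq {n : ℕ} (v x : EuclideanSpace ℝ (Fin n)) :
    projOnto v x = (inner ℝ v x / ‖v‖ ^ 2) • v := by
  rw [projOnto, Submodule.starProjection_singleton]
  simp

lemma norm_projOnto {n : ℕ} (v x : EuclideanSpace ℝ (Fin n)) (hv : 0 < ‖v‖) :
    ‖projOnto v x‖ = |inner ℝ v x| / ‖v‖ := by
  rw [projOnto_eq, norm_smul, Real.norm_eq_abs, abs_div, abs_of_pos (pow_pos hv 2)]
  field_simp

lemma norm_projOnto_sub {n : ℕ} {v w : EuclideanSpace ℝ (Fin n)} {r : ℝ} (hr : 0 < r)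
    (hv : ‖v‖ = r) (hw : ‖w‖ = r) : ‖projOnto w v - w‖ = r - inner ℝ v w / r := by
  have h1 : projOnto w v - w = -(1 - inner ℝ v w / r ^ 2) • w := by
    rw [projOnto_eq, hw, real_inner_comm]; module
  have h2 : inner ℝ v w ≤ r ^ 2 := by
    have := real_inner_le_norm v w
    rw [hv, hw] at this; linarith [sq r]
  have h3 : 0 ≤ 1 - inner ℝ v w / r ^ 2 := by
    rw [sub_nonneg, div_le_one (by positivity)]; exact h2
  rw [h1, norm_smul, norm_neg, Real.norm_of_nonneg h3, hw]
  field_simp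

/-- As `x ⊥ a`, only the part of `b` orthogonal to `a` matters. When `b` is close to `a` that part
is short: its square is at most `2 r` times the angular gap `r - ⟨a, b⟩ / r`. -/
lemma inner_sq_le_of_orthogonal {E : Type*} [NormedAddCommGroup E] [InnerProductSpace ℝ E]
    {a b x : E} {r : ℝ} (hr : 0 < r) (ha : ‖a‖ = r) (hb : ‖b‖ = r) (hx : inner ℝ x a = 0) :
    inner ℝ x b ^ 2 ≤ ‖x‖ ^ 2 * (2 * r * (r - inner ℝ a b / r)) := by
  set g : ℝ := inner ℝ a b
  have h1 : inner ℝ x b = inner ℝ x (b - (g / r ^ 2) • a) := by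
    rw [inner_sub_right, inner_smul_right, hx]; ring
  have h2 : ‖b - (g / r ^ 2) • a‖ ^ 2 = r ^ 2 - g ^ 2 / r ^ 2 := by
    rw [norm_sub_sq_real, inner_smul_right, real_inner_comm, norm_smul, ha, hb, mul_pow,
      Real.norm_eq_abs, sq_abs]
    change r ^ 2 - 2 * (g / r ^ 2 * g) + (g / r ^ 2) ^ 2 * r ^ 2 = _
    field_simp
    ring
  have h3 : r ^ 2 - g ^ 2 / r ^ 2 ≤ 2 * r * (r - g / r) := by
    have : 2 * r * (r - g / r) - (r ^ 2 - g ^ 2 / r ^ 2) = (r - g / r) ^ 2 := by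
      field_simp; ring
    nlinarith [sq_nonneg (r - g / r)]
  calc inner ℝ x b ^ 2 ≤ (‖x‖ * ‖b - (g / r ^ 2) • a‖) ^ 2 := by
        rw [h1, ← sq_abs]
        exact pow_le_pow_left₀ (abs_nonneg _) (abs_real_inner_le_norm _ _) 2
    _ ≤ _ := by
        rw [mul_pow, h2]
        exact mul_le_mul_of_nonneg_left h3 (sq_nonneg _)

lemma poissonProd_inner_tail {n : ℕ} {A : ℝ} {u b : EuclideanSpace ℝ (Fin n)} (hA : 0 ≤ A)
    (hu : ∀ t, u t ∈ Set.Icc 0 A) (hb : 0 < ‖b‖) (τ : ℝ) :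
    (poissonProd fun t => u t).real
      {y | τ ≤ |inner ℝ b (WithLp.toLp 2 (fun t => (y t : ℝ)) - u)| / ‖b‖} ≤
      2 * Real.exp (6 * A - 2 * τ) := by
  have hv : ∑ t, (b t / ‖b‖) ^ 2 = 1 := by
    simp_rw [div_pow]
    rw [← Finset.sum_div, EuclideanSpace.norm_sq_eq]
    simp only [Real.norm_eq_abs, sq_abs]
    rw [div_self]
    have := EuclideanSpace.norm_sq_eq b
    simp only [Real.norm_eq_abs, sq_abs] at this
    rw [← this]; positivity
  convert poissonProd_tail hA hu hv τ using 6 with y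
  rw [← abs_of_pos hb, ← abs_div, abs_of_pos hb, PiLp.inner_apply, Finset.sum_div]
  congr 1
  refine Finset.sum_congr rfl fun t _ => ?_
  simp
  ring

namespace PrimitiveCodebook

variable {n L : ℕ} {c : EuclideanSpace ℝ (Fin n)} {r : Fin L → ℝ} {d : ℝ}

lemma norm_disp (B : PrimitiveCodebook n L c r d) (s : B.Address) (ℓ : Fin L) :
    ‖B.disp s ℓ‖ = r ℓ := by
  have := (B.angleDense s ℓ).1 (s ℓ)
  simp only [Function.update_eq_self] at this
  exact this

lemma disp_congr (B : PrimitiveCodebook n L c r d) {s s' : B.Address} {ℓ : Fin L}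
    (h : ∀ k ≤ ℓ, s k = s' k) : B.disp s ℓ = B.disp s' ℓ := by
  rw [disp, disp, B.point_congr s s' ℓ.succ, B.point_congr s s' ℓ.castSucc]
  · exact fun k hk => h k (le_of_lt hk)
  · exact fun k hk => h k (Nat.lt_succ_iff.1 (by simpa using hk))

lemma le_norm_projOnto_sub (B : PrimitiveCodebook n L c r d) {s s' : B.Address} {ℓ : Fin L}
    (h : ∀ k < ℓ, s k = s' k) (hne : s ℓ ≠ s' ℓ) :
    d ≤ ‖projOnto (B.disp s' ℓ) (B.disp s ℓ) - B.disp s' ℓ‖ := by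
  have := (B.angleDense s ℓ).2 (s ℓ) (s' ℓ) hne
  simp only [Function.update_eq_self] at this
  have h' : B.disp (Function.update s ℓ (s' ℓ)) ℓ = B.disp s' ℓ := by
    refine B.disp_congr fun k hk => ?_
    rcases hk.eq_or_lt with rfl | hk
    · simp
    · rw [Function.update_of_ne hk.ne, h k hk]
  rw [← h']
  exact this

lemma point_eq (B : PrimitiveCodebook n L c r d) (s : B.Address) (m : Fin (L + 1)) :
    B.point s m = c + ∑ k : Fin L with k.val < m.val, B.disp s k := by
  induction m using Fin.induction with
  | zero => simp [B.point_zero]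
  | succ m ih =>
    have h1 : (Finset.univ.filter fun k : Fin L => k.val < m.succ.val) =
        insert m (Finset.univ.filter fun k : Fin L => k.val < m.castSucc.val) := by
      ext k
      simp only [Finset.mem_filter, Finset.mem_univ, true_and, Finset.mem_insert, Fin.ext_iff,
        Fin.val_succ, Fin.val_castSucc]
      omega
    rw [h1, Finset.sum_insert (by simp), add_left_comm, ← ih, disp, sub_add_cancel]

lemma word_sub_point (B : PrimitiveCodebook n L c r d) (s : B.Address) (ℓ : Fin L) :
    B.word s - B.point s ℓ.succ = ∑ k : Fin L with ℓ < k, B.disp s k := by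
  rw [word, B.point_eq s (Fin.last L), B.point_eq s ℓ.succ, add_sub_add_left_eq_sub,
    sub_eq_iff_eq_add, ← Finset.sum_union]
  · refine Finset.sum_congr ?_ fun _ _ => rfl
    ext k
    simp only [Finset.mem_filter, Finset.mem_univ, true_and, Finset.mem_union, Fin.lt_def,
      Fin.val_succ, Fin.val_last]
    omega
  · rw [Finset.disjoint_filter]
    intro k _ h1 h2
    simp only [Fin.lt_def, Fin.val_succ] at h1 h2
    omega

lemma inner_word_sub_point (B : PrimitiveCodebook n L c r d) (s : B.Address) (ℓ : Fin L) :
    inner ℝ (B.word s - B.point s ℓ.succ) (B.disp s ℓ) = 0 := by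
  rw [word_sub_point, sum_inner]
  refine Finset.sum_eq_zero fun k hk => ?_
  exact B.orthogonal s k ℓ (by simpa using (Finset.mem_filter.1 hk).2.ne')

lemma norm_word_sub_point_le (B : PrimitiveCodebook n L c r d) (s : B.Address) (ℓ : Fin L) {R : ℝ}
    (hR : 0 ≤ R) (h : ∀ k, ℓ < k → r k ≤ R) : ‖B.word s - B.point s ℓ.succ‖ ≤ L * R := by
  rw [word_sub_point]
  calc _ ≤ ∑ k : Fin L with ℓ < k, R := norm_sum_le_of_le _ fun k hk => by
        rw [norm_disp]; exact h k (Finset.mem_filter.1 hk).2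
    _ ≤ ∑ k : Fin L, R := Finset.sum_le_sum_of_subset_of_nonneg (Finset.subset_univ _)
        fun _ _ _ => hR
    _ = L * R := by simp

/-- If the words `s`, `s'` first differ in layer `ℓ`, then the word `s` is far from the slab of `s'`
in that layer. -/
lemma le_abs_inner_word_sub_point (B : PrimitiveCodebook n L c r d) {s s' : B.Address} {ℓ : Fin L}
    (h : ∀ k < ℓ, s k = s' k) (hne : s ℓ ≠ s' ℓ) {A : ℝ} (hA : 0 < A) (hr : 0 < r ℓ)
    (hrk : ∀ k, ℓ < k → r k ≤ √(A * r ℓ)) (hd : 18 * A * L ^ 2 ≤ d) (hd0 : 0 < d) :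
    2 / 3 * d ≤ |inner ℝ (B.disp s' ℓ) (B.word s - B.point s' ℓ.succ)| / r ℓ := by
  set a := B.disp s ℓ
  set b := B.disp s' ℓ
  set x := B.word s - B.point s ℓ.succ
  have ha : ‖a‖ = r ℓ := B.norm_disp s ℓ
  have hb : ‖b‖ = r ℓ := B.norm_disp s' ℓ
  set t := r ℓ - inner ℝ a b / r ℓ
  have ht : d ≤ t := by
    refine le_trans ?_ (norm_projOnto_sub hr ha hb).le
    exact B.le_norm_projOnto_sub h hne
  have hx : ‖x‖ ≤ L * √(A * r ℓ) := B.norm_word_sub_point_le s ℓ (Real.sqrt_nonneg _) hrk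
  have hx2 : ‖x‖ ^ 2 ≤ L ^ 2 * (A * r ℓ) := by
    rw [← Real.sq_sqrt (mul_pos hA hr).le, ← mul_pow]
    exact pow_le_pow_left₀ (norm_nonneg _) hx 2
  -- The later layers `x` of the sent word cancel at most a third of the gap `t`: the square of
  -- their contribution is at most `2 A L² r² t`, which is below `r² t² / 9` as soon as `t ≥ 18 A
  -- L²`.
  have hxb : inner ℝ x b ^ 2 ≤ (r ℓ * (t / 3)) ^ 2 := by
    refine (inner_sq_le_of_orthogonal hr ha hb (B.inner_word_sub_point s ℓ)).trans ?_
    have ht0 : 0 < t := hd0.trans_le ht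
    calc ‖x‖ ^ 2 * (2 * r ℓ * t) ≤ L ^ 2 * (A * r ℓ) * (2 * r ℓ * t) :=
          mul_le_mul_of_nonneg_right hx2 (by positivity)
      _ = r ℓ ^ 2 * t * (18 * A * L ^ 2) / 9 := by ring
      _ ≤ r ℓ ^ 2 * t * t / 9 := by
          gcongr
          linarith
      _ = _ := by ring
  have ht0 : 0 < t := hd0.trans_le ht
  have hxb' := abs_le_of_sq_le_sq hxb (by positivity)
  have hpt : B.point s ℓ.castSucc = B.point s' ℓ.castSucc :=
    B.point_congr _ _ _ fun k hk => h k hk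
  have hsplit : B.word s - B.point s' ℓ.succ = x + a - b := by
    simp only [x, a, b, disp, hpt]; abel
  have hin : inner ℝ b (x + a - b) = inner ℝ x b - r ℓ * t := by
    rw [inner_sub_right, inner_add_right, real_inner_self_eq_norm_sq, hb, real_inner_comm x b,
      real_inner_comm a b]
    simp only [t]
    field_simp
    ring
  rw [hsplit, hin, le_div_iff₀ hr, abs_sub_comm]
  refine le_trans ?_ (le_abs_self _)
  have := le_of_abs_le hxb'
  nlinarith

end PrimitiveCodebook

/-- The tail is of order `n^(-2A)` and the target of order `n^(-3A/2)`; the spare factor `n^(A/2)`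
absorbs every constant, including the number of layers. -/
lemma eventually_tail_le_poissonError {A : ℝ} (hA : 0 < A) (K : ℝ) :
    ∀ᶠ n : ℕ in atTop, K * (2 * Real.exp (6 * A - 2 * (A * Real.log n))) ≤ poissonError A n := by
  have hlog : Tendsto (fun n : ℕ => Real.log n) atTop atTop :=
    Real.tendsto_log_atTop.comp tendsto_natCast_atTop_atTop
  have h := (hlog.const_mul_atTop (by positivity : 0 < A / 2)).eventually_ge_atTop
    (6 * A + Real.log (2 * (|K| + 1)))
  filter_upwards [h] with n hn
  have hK : 0 < 2 * (|K| + 1) := by positivity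
  calc K * (2 * Real.exp (6 * A - 2 * (A * Real.log n)))
      ≤ 2 * (|K| + 1) * Real.exp (6 * A - 2 * (A * Real.log n)) := by
        rw [← mul_assoc, mul_comm K]
        gcongr
        linarith [le_abs_self K]
    _ = Real.exp (Real.log (2 * (|K| + 1)) + (6 * A - 2 * (A * Real.log n))) := by
        rw [Real.exp_add, Real.exp_log hK]
    _ ≤ poissonError A n := by
        refine Real.exp_le_exp.2 ?_
        nlinarith

lemma eventually_isDICode {A : ℝ} (hA : 0 < A) (L : ℕ) {δ : ℝ} (hδ1 : δ < 1) :
    ∀ᶠ n : ℕ in atTop, ∀ B : PoissonCodebook A δ L n,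
      IsDICode (poissonChannel A) (B.input A)
        (fun s : B.Message A => B.decoder (A * Real.log n) s.1)
        (poissonError A n) (poissonError A n) := by
  have hlog : Tendsto (fun n : ℕ => Real.log n) atTop atTop :=
    Real.tendsto_log_atTop.comp tendsto_natCast_atTop_atTop
  filter_upwards [eventually_tail_le_poissonError hA L, eventually_tail_le_poissonError hA 1,
    hlog.eventually_ge_atTop (6 * L ^ 2), hlog.eventually_gt_atTop 0, eventually_ge_atTop 1]
    with n hL h1 hl hl0 hn B
  have hn1 : (1 : ℝ) ≤ n := by exact_mod_cast hn
  have hr : ∀ ℓ : Fin L, 0 < A * (n : ℝ) ^ ((1 - δ) / 2 ^ (ℓ.val + 1)) := fun ℓ => by positivity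
  have hproj : ∀ (s : B.Address) (ℓ : Fin L) x,
      ‖projOnto (B.disp s ℓ) x‖ = |inner ℝ (B.disp s ℓ) x| / ‖B.disp s ℓ‖ := fun s ℓ x =>
    norm_projOnto _ _ (by rw [B.norm_disp]; exact hr ℓ)
  refine ⟨Real.exp_pos _, Real.exp_pos _, fun i => (Set.to_countable _).measurableSet, ?_, ?_⟩
  · intro s
    have hm : MeasurableSet (B.decoder (A * Real.log n) s.1) := (Set.to_countable _).measurableSet
    rw [blockLaw_poissonChannel, sub_le_comm, ← probReal_compl_eq_one_sub hm]
    refine le_trans ?_ hL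
    -- Replacing the layer's point by the full word leaves the statistic unchanged, since the later
    -- displacements are orthogonal to this one; the statistic becomes centred.
    have hsub : (B.decoder (A * Real.log n) s.1)ᶜ ⊆ ⋃ ℓ : Fin L,
        {y | A * Real.log n ≤ |inner ℝ (B.disp s.1 ℓ)
          (WithLp.toLp 2 (fun t => (y t : ℝ)) - B.word s.1)| / ‖B.disp s.1 ℓ‖} := by
      intro y hy
      simp only [PrimitiveCodebook.decoder, Set.mem_compl_iff, Set.mem_ofPred_eq, not_forall,
        not_le] at hy
      obtain ⟨ℓ, hℓ⟩ := hy
      refine Set.mem_iUnion.2 ⟨ℓ, ?_⟩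
      rw [hproj] at hℓ
      have : inner ℝ (B.disp s.1 ℓ) (WithLp.toLp 2 (fun t => (y t : ℝ)) - B.word s.1) =
          inner ℝ (B.disp s.1 ℓ)
            (WithLp.toLp 2 (fun t => (y t : ℝ)) - B.point s.1 ℓ.succ) := by
        have h0 := B.inner_word_sub_point s.1 ℓ
        rw [real_inner_comm] at h0
        rw [← sub_sub_sub_cancel_right _ _ (B.point s.1 ℓ.succ), inner_sub_right, h0, sub_zero]
      rw [Set.mem_ofPred_eq, this]
      exact hℓ.le
    calc _ ≤ _ := measureReal_mono hsub
      _ ≤ _ := measureReal_iUnion_fintype_le _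
      _ ≤ ∑ _ℓ : Fin L, 2 * Real.exp (6 * A - 2 * (A * Real.log n)) :=
        Finset.sum_le_sum fun ℓ _ => poissonProd_inner_tail hA.le s.2
          (by rw [B.norm_disp]; exact hr ℓ) _
      _ = _ := by simp
  · intro s s' hss
    rw [blockLaw_poissonChannel]
    refine le_trans ?_ h1
    rw [one_mul]
    have hne : ∃ ℓ, s.1 ℓ ≠ s'.1 ℓ := by
      by_contra! hc
      exact hss (Subtype.ext (funext hc))
    obtain ⟨ℓ, hℓ⟩ := exists_minimal_of_wellFoundedLT _ hne
    have hlt : ∀ k < ℓ, s.1 k = s'.1 k := fun k hk => by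
      by_contra hc
      exact hℓ.not_prop_of_lt hk hc
    -- The shift is at least `(2/3) · 3 A log n = 2 A log n`. Acceptance leaves at most `A log n`,
    -- so the noise must supply at least `A log n`.
    have hfar := B.le_abs_inner_word_sub_point hlt hℓ.prop hA (hr ℓ) ?_ ?_ (by positivity)
    · refine (measureReal_mono ?_).trans (poissonProd_inner_tail (b := B.disp s'.1 ℓ) hA.le s.2
        (by rw [B.norm_disp]; exact hr ℓ) (A * Real.log n))
      intro y hy
      have hy := hy ℓ
      rw [hproj] at hy
      rw [← B.norm_disp s'.1 ℓ] at hfar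
      rw [Set.mem_ofPred_eq]
      have htri : |inner ℝ (B.disp s'.1 ℓ) (B.word s.1 - B.point s'.1 ℓ.succ)| ≤
          |inner ℝ (B.disp s'.1 ℓ)
            (WithLp.toLp 2 (fun t => (y t : ℝ)) - B.point s'.1 ℓ.succ)| +
          |inner ℝ (B.disp s'.1 ℓ) (WithLp.toLp 2 (fun t => (y t : ℝ)) - B.word s.1)| := by
        have hsplit : B.word s.1 - B.point s'.1 ℓ.succ =
            (WithLp.toLp 2 (fun t => (y t : ℝ)) - B.point s'.1 ℓ.succ) -
              (WithLp.toLp 2 (fun t => (y t : ℝ)) - B.word s.1) := by abel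
        rw [hsplit, inner_sub_right _ (_ - _) (_ - _)]
        exact norm_sub_le (E := ℝ) _ _
      have := (div_le_div_iff_of_pos_right (by rw [B.norm_disp]; exact hr ℓ :
        0 < ‖B.disp s'.1 ℓ‖)).2 htri
      rw [add_div] at this
      linarith
    · intro k hk
      refine Real.le_sqrt_of_sq_le ?_
      -- The exponents at least halve from layer `ℓ` to any later one, which gives `r k ≤ √(A * r
      -- ℓ)`.
      have hexp : 2 * ((1 - δ) / 2 ^ (k.val + 1)) ≤ (1 - δ) / 2 ^ (ℓ.val + 1) := by
        have hk' : ℓ.val + 1 + 1 ≤ k.val + 1 := by have := Fin.lt_def.1 hk; omega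
        have h2 : (2 : ℝ) ^ (ℓ.val + 1) * 2 ≤ 2 ^ (k.val + 1) := by
          rw [← pow_succ]; exact pow_le_pow_right₀ (by norm_num) hk'
        rw [← mul_div_assoc, div_le_div_iff₀ (by positivity) (by positivity)]
        nlinarith
      rw [mul_pow, ← Real.rpow_natCast ((n : ℝ) ^ _), ← Real.rpow_mul (by positivity), ← mul_assoc,
        ← sq]
      refine mul_le_mul_of_nonneg_left (Real.rpow_le_rpow_of_exponent_le hn1 ?_) (sq_nonneg _)
      push_cast; linarith
    · nlinarith

/-! ### Separated families of integer vectors -/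

lemma exists_card_le_card_fiber_mul {α β : Type*} [DecidableEq β] (s : Finset α) {T : Finset β}
    (hT : T.Nonempty) {f : α → β} (hf : ∀ a ∈ s, f a ∈ T) :
    ∃ b ∈ T, s.card ≤ (s.filter fun a => f a = b).card * T.card := by
  obtain ⟨b, hb, hmax⟩ := T.exists_max_image (fun b => (s.filter fun a => f a = b).card) hT
  refine ⟨b, hb, ?_⟩
  rw [Finset.card_eq_sum_card_fiberwise hf, mul_comm]
  exact Finset.sum_le_card_nsmul T _ _ hmax

/-- Union bound over the `m`-sets of coordinates on which membership holds. It serves both to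
discard vectors near a base point and to bound Hamming balls. -/
lemma card_filter_many_mem_le {n q g m : ℕ} (G : Fin n → Finset (Fin q))
    (hG : ∀ t, (G t).card ≤ g) :
    (Finset.univ.filter fun x : Fin n → Fin q =>
      m ≤ (Finset.univ.filter fun t => x t ∈ G t).card).card ≤ 2 ^ n * (g ^ m * q ^ (n - m)) := by
  classical
  have hsub : (Finset.univ.filter fun x : Fin n → Fin q =>
      m ≤ (Finset.univ.filter fun t => x t ∈ G t).card) ⊆
      (Finset.powersetCard m (Finset.univ : Finset (Fin n))).biUnion fun T =>
        Fintype.piFinset fun t => if t ∈ T then G t else Finset.univ := by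
    intro x hx
    obtain ⟨T, hT, hTm⟩ := Finset.exists_subset_card_eq (Finset.mem_filter.1 hx).2
    refine Finset.mem_biUnion.2 ⟨T, Finset.mem_powersetCard.2 ⟨Finset.subset_univ _, hTm⟩, ?_⟩
    rw [Fintype.mem_piFinset]
    intro t
    split_ifs with ht
    · exact (Finset.mem_filter.1 (hT ht)).2
    · exact Finset.mem_univ _
  calc _ ≤ _ := Finset.card_le_card hsub
    _ ≤ _ := Finset.card_biUnion_le
    _ ≤ ∑ T ∈ Finset.powersetCard m (Finset.univ : Finset (Fin n)), g ^ m * q ^ (n - m) := by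
        refine Finset.sum_le_sum fun T hT => ?_
        have hTm := (Finset.mem_powersetCard.1 hT).2
        rw [Fintype.card_piFinset]
        calc ∏ t, (if t ∈ T then G t else Finset.univ).card
            ≤ ∏ t, (if t ∈ T then g else q) := by
              refine Finset.prod_le_prod' fun t _ => ?_
              split_ifs
              · exact hG t
              · simp
          _ = g ^ m * q ^ (n - m) := by
              rw [Finset.prod_ite]
              simp only [Finset.prod_const, Finset.filter_univ_mem, hTm]
              congr 2
              have : (Finset.univ.filter fun t => t ∉ T) = Tᶜ := by ext; simp
              rw [this, Finset.card_compl, hTm, Fintype.card_fin]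
    _ ≤ 2 ^ n * (g ^ m * q ^ (n - m)) := by
        rw [Finset.sum_const, smul_eq_mul, Finset.card_powersetCard, Finset.card_univ,
          Fintype.card_fin]
        exact Nat.mul_le_mul_right _ (Nat.choose_le_two_pow n m)

/-- The Gilbert-Varshamov bound. -/
lemma exists_separated_subset {α : Type*} (s : Finset α) (close : α → α → Prop)
    [DecidableRel close] (hrefl : ∀ x, close x x) (hsymm : ∀ x y, close x y → close y x) {b : ℕ}
    (hb : ∀ y, (s.filter fun x => close x y).card ≤ b) :
    ∃ S ⊆ s, (∀ x ∈ S, ∀ y ∈ S, x ≠ y → ¬ close x y) ∧ s.card ≤ S.card * b := by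
  classical
  obtain ⟨P, hP⟩ : ∃ P : Finset α → Prop, ∀ S, P S ↔ ∀ x ∈ S, ∀ y ∈ S, x ≠ y → ¬ close x y :=
    ⟨_, fun _ => Iff.rfl⟩
  obtain ⟨S, hS, hmax⟩ := (s.powerset.filter P).exists_max_image Finset.card
    ⟨∅, by simp [hP]⟩
  obtain ⟨hSs, hsep⟩ := Finset.mem_filter.1 hS
  rw [hP] at hsep
  rw [Finset.mem_powerset] at hSs
  refine ⟨S, hSs, hsep, ?_⟩
  have hcov : s ⊆ S.biUnion fun y => s.filter fun x => close x y := by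
    intro x hx
    by_contra hc
    have hx' : ∀ y ∈ S, ¬ close x y := fun y hy hxy =>
      hc (Finset.mem_biUnion.2 ⟨y, hy, Finset.mem_filter.2 ⟨hx, hxy⟩⟩)
    have hxS : x ∉ S := fun h => hx' x h (hrefl x)
    have := hmax (insert x S) ?_
    · rw [Finset.card_insert_of_notMem hxS] at this
      omega
    · refine Finset.mem_filter.2 ⟨Finset.mem_powerset.2 (Finset.insert_subset hx hSs),
        (hP _).2 fun y hy w hw hne => ?_⟩
      rcases Finset.mem_insert.1 hy with hyx | hyS <;> rcases Finset.mem_insert.1 hw with hwx | hwS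
      · exact absurd (hyx.trans hwx.symm) hne
      · exact hyx ▸ hx' w hwS
      · exact fun h => hx' y hyS (hsymm _ _ (hwx ▸ h))
      · exact hsep y hyS w hwS hne
  calc s.card ≤ _ := Finset.card_le_card hcov
    _ ≤ _ := Finset.card_biUnion_le
    _ ≤ S.card * b := by
        rw [← smul_eq_mul, ← Finset.sum_const]
        exact Finset.sum_le_sum fun y _ => hb y

lemma card_filter_abs_sub_lt_le {q p : ℕ} (c : ℤ) :
    (Finset.univ.filter fun a : Fin q => |(a : ℤ) - c| < p).card ≤ 2 * p := by
  calc _ ≤ (Finset.Ioo (c - p) (c + p)).card := by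
        refine Finset.card_le_card_of_injOn (fun a : Fin q => (a : ℤ)) ?_ ?_
        · intro a ha
          have := abs_lt.1 (Finset.mem_filter.1 ha).2
          simp only [Finset.coe_Ioo, Set.mem_Ioo]
          constructor <;> linarith
        · intro a _ b _ hab
          exact Fin.ext (Int.ofNat_inj.1 hab)
    _ ≤ 2 * p := by
        rw [Int.card_Ioo]
        omega

lemma abs_sum_mul_le {n : ℕ} {x z : Fin n → ℤ} {a b : ℤ} (ha : 0 ≤ a) (hx : ∀ t, |x t| ≤ a)
    (hz : ∀ t, |z t| ≤ b) : |∑ t, x t * z t| ≤ n * (a * b) := by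
  calc |∑ t, x t * z t| ≤ ∑ t, |x t * z t| := Finset.abs_sum_le_sum_abs _ _
    _ ≤ ∑ _t : Fin n, a * b := Finset.sum_le_sum fun t _ => by
        rw [abs_mul]; exact mul_le_mul (hx t) (hz t) (abs_nonneg _) ha
    _ = n * (a * b) := by simp

/-- Many integer vectors of equal norm that are orthogonal to given integer vectors and differ
pairwise in many coordinates. -/
lemma exists_separated_orthogonal {n p h L : ℕ} (z : ℕ → Fin n → ℤ) (hz : ∀ k t, |z k t| ≤ n)
    (hp : 1 ≤ p) (hq : 32 * p ≤ n) (hh : h ≤ n) (hlab : 2 * (2 * n ^ 3 + 1) ^ L ≤ 2 ^ n) :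
    ∃ (S : Finset (Fin n → ℤ)) (M : ℤ), (n * p ^ 2 : ℤ) ≤ 2 * M ∧ M ≤ n * (32 * p) ^ 2 ∧
      (∀ w ∈ S, (∀ t, |w t| ≤ 32 * p) ∧ (∀ k < L, ∑ t, w t * z k t = 0) ∧ ∑ t, w t ^ 2 = M) ∧
      (∀ w ∈ S, ∀ w' ∈ S, w ≠ w' → (h : ℤ) ≤ ∑ t, (w t - w' t) ^ 2) ∧
      (32 * p) ^ n ≤ S.card *
        (2 * (2 * n ^ 3 + 1) ^ L * (n * (32 * p) ^ 2 + 1) * (2 ^ n * (32 * p) ^ h)) := by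
  classical
  set q := 32 * p with hqdef
  have hn0 : 0 < n := by omega
  have hx0 : ∀ (x : Fin n → Fin q) t, (0 : ℤ) ≤ (x t : ℤ) ∧ (x t : ℤ) < q := fun x t =>
    ⟨by positivity, by exact_mod_cast (x t).2⟩
  -- Two box points with the same inner products against the given vectors differ by a vector
  -- orthogonal to all of them. A most popular fibre with a base point `x₀` in it therefore supplies
  -- the orthogonal family.
  let f : (Fin n → Fin q) → Fin L → ℤ := fun x k => ∑ t, (x t : ℤ) * z k t
  let T : Finset (Fin L → ℤ) := Fintype.piFinset fun _ => Finset.Icc (-(n : ℤ) ^ 3) ((n : ℤ) ^ 3)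
  have hTc : T.card = (2 * n ^ 3 + 1) ^ L := by
    rw [Fintype.card_piFinset_const, Int.card_Icc]
    congr 1
    have : (n : ℤ) ^ 3 + 1 - -(n : ℤ) ^ 3 = ((2 * n ^ 3 + 1 : ℕ) : ℤ) := by push_cast; ring
    rw [this, Int.toNat_natCast]
  have hf : ∀ x ∈ (Finset.univ : Finset (Fin n → Fin q)), f x ∈ T := by
    intro x _
    rw [Fintype.mem_piFinset]
    intro k
    rw [Finset.mem_Icc, ← abs_le]
    refine (abs_sum_mul_le (a := n) (b := n) (by positivity) (fun t => ?_) (hz k)).trans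
      (by ring_nf; rfl)
    rw [abs_of_nonneg (hx0 x t).1]
    have := (hx0 x t).2
    have : (q : ℤ) ≤ n := by exact_mod_cast hq
    linarith
  have hTne : T.Nonempty := by
    rw [← Finset.card_pos, hTc]; positivity
  obtain ⟨b, -, hC1⟩ := exists_card_le_card_fiber_mul Finset.univ hTne hf
  set C1 := (Finset.univ : Finset (Fin n → Fin q)).filter fun a => f a = b
  rw [Finset.card_univ, Fintype.card_fun, Fintype.card_fin, Fintype.card_fin, hTc] at hC1
  have hqn : 0 < q ^ n := by positivity
  have hC1ne : C1.Nonempty := by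
    rw [← Finset.card_pos]
    exact Nat.pos_of_mul_pos_right (hqn.trans_le hC1)
  obtain ⟨x₀, hx₀⟩ := hC1ne
  -- Discarding points close to `x₀` in half of the coordinates keeps the common squared norm of
  -- order `n p²`.
  set near : (Fin n → Fin q) → ℕ := fun x =>
    (Finset.univ.filter fun t => |(x t : ℤ) - (x₀ t : ℤ)| < p).card
  set m := (n + 1) / 2
  have hmn : m ≤ n := by omega
  set Cl := Finset.univ.filter fun x : Fin n → Fin q => m ≤ near x
  have hCl : Cl.card ≤ 2 ^ n * ((2 * p) ^ m * q ^ (n - m)) := by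
    have := card_filter_many_mem_le (m := m)
      (fun t => Finset.univ.filter fun a : Fin q => |(a : ℤ) - (x₀ t : ℤ)| < p)
      (fun t => card_filter_abs_sub_lt_le (x₀ t : ℤ))
    simpa [Cl, near] using this
  -- The side `32 p = 16 · 2 p` is chosen here: `2 m ≥ n` gives `4 ^ n ≤ 16 ^ m`, which pays for
  -- both the choice of coordinates and the labels. At most half of the fibre is lost.
  have hCl2 : 2 * (2 * n ^ 3 + 1) ^ L * Cl.card ≤ q ^ n := by
    calc _ ≤ 2 ^ n * (2 ^ n * ((2 * p) ^ m * q ^ (n - m))) := Nat.mul_le_mul hlab hCl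
      _ = 4 ^ n * ((2 * p) ^ m * q ^ (n - m)) := by
          rw [← mul_assoc, ← mul_pow]; norm_num
      _ ≤ 16 ^ m * ((2 * p) ^ m * q ^ (n - m)) := by
          refine Nat.mul_le_mul_right _ ?_
          rw [show (16 : ℕ) = 4 ^ 2 by norm_num, ← pow_mul]
          exact Nat.pow_le_pow_right (by norm_num) (by omega)
      _ = q ^ m * q ^ (n - m) := by
          rw [← mul_assoc, ← mul_pow, hqdef]; congr 2; ring
      _ = q ^ n := by rw [← pow_add]; congr 1; omega
  have hCl3 : 2 * Cl.card ≤ C1.card := by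
    have h1 : 2 * Cl.card * (2 * n ^ 3 + 1) ^ L ≤ C1.card * (2 * n ^ 3 + 1) ^ L := by
      calc _ = 2 * (2 * n ^ 3 + 1) ^ L * Cl.card := by ring
        _ ≤ _ := hCl2.trans hC1
    exact Nat.le_of_mul_le_mul_right h1 (by positivity)
  have hC2 : C1.card ≤ 2 * (C1 \ Cl).card := by
    have := Finset.le_card_sdiff Cl C1
    omega
  let N2 : (Fin n → Fin q) → ℤ := fun x => ∑ t, ((x t : ℤ) - (x₀ t : ℤ)) ^ 2
  have hdiff : ∀ (x : Fin n → Fin q) t, |(x t : ℤ) - (x₀ t : ℤ)| ≤ q := by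
    intro x t
    rw [abs_le]
    have := hx0 x t
    have := hx0 x₀ t
    constructor <;> linarith
  have hN2 : ∀ x ∈ C1 \ Cl, N2 x ∈ Finset.Icc (0 : ℤ) (n * q ^ 2) := by
    intro x _
    rw [Finset.mem_Icc]
    refine ⟨Finset.sum_nonneg fun t _ => sq_nonneg _, ?_⟩
    calc N2 x ≤ ∑ _t : Fin n, (q : ℤ) ^ 2 := Finset.sum_le_sum fun t _ => by
          rw [← sq_abs]; exact pow_le_pow_left₀ (abs_nonneg _) (hdiff x t) 2
      _ = n * q ^ 2 := by simp
  obtain ⟨M, hM, hC3⟩ := exists_card_le_card_fiber_mul _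
    (Finset.nonempty_Icc.2 (by positivity : (0 : ℤ) ≤ n * q ^ 2)) hN2
  set C3 := (C1 \ Cl).filter fun a => N2 a = M
  have hIcc : (Finset.Icc (0 : ℤ) (n * q ^ 2)).card = n * q ^ 2 + 1 := by
    rw [Int.card_Icc]
    have : (n : ℤ) * q ^ 2 + 1 - 0 = ((n * q ^ 2 + 1 : ℕ) : ℤ) := by push_cast; ring
    rw [this, Int.toNat_natCast]
  rw [hIcc] at hC3
  -- Agreement in at least `n - h` coordinates is the closeness relation; separated integer vectors
  -- then differ by at least `1` in at least `h` coordinates.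
  have hball : ∀ y : Fin n → Fin q, (C3.filter fun x =>
      n - h ≤ (Finset.univ.filter fun t => x t = y t).card).card ≤ 2 ^ n * q ^ h := by
    intro y
    have h1 := card_filter_many_mem_le (q := q) (m := n - h) (fun t => {y t})
      (fun t => (Finset.card_singleton (y t)).le)
    rw [one_pow, one_mul, Nat.sub_sub_self hh] at h1
    refine (Finset.card_le_card ?_).trans h1
    intro x hx
    simpa using (Finset.mem_filter.1 hx).2
  obtain ⟨S, hSC, hsep, hScard⟩ := exists_separated_subset C3
    (fun x y => n - h ≤ (Finset.univ.filter fun t => x t = y t).card)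
    (fun x => by simp) (fun x y hxy => by simpa only [eq_comm] using hxy) hball
  have htotal : q ^ n ≤ S.card * (2 * (2 * n ^ 3 + 1) ^ L * (n * q ^ 2 + 1) * (2 ^ n * q ^ h)) := by
    calc q ^ n ≤ C1.card * (2 * n ^ 3 + 1) ^ L := hC1
      _ ≤ 2 * (S.card * (2 ^ n * q ^ h) * (n * q ^ 2 + 1)) * (2 * n ^ 3 + 1) ^ L := by
          refine Nat.mul_le_mul_right _ (hC2.trans (Nat.mul_le_mul_left _ (hC3.trans ?_)))
          exact Nat.mul_le_mul_right _ hScard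
      _ = _ := by ring
  let e : (Fin n → Fin q) → Fin n → ℤ := fun x t => (x t : ℤ) - (x₀ t : ℤ)
  have he : Function.Injective e := by
    intro x y hxy
    funext t
    have := congrFun hxy t
    simp only [e, sub_left_inj] at this
    exact Fin.ext (by exact_mod_cast this)
  have hSne : S.Nonempty := by
    rw [← Finset.card_pos]
    exact Nat.pos_of_mul_pos_right (hqn.trans_le htotal)
  have hq' : (q : ℤ) = 32 * p := by rw [hqdef]; push_cast; ring
  refine ⟨S.image e, M, ?_, ?_, ?_, ?_, ?_⟩
  · obtain ⟨x, hx⟩ := hSne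
    obtain ⟨hx1, hx2⟩ := Finset.mem_filter.1 (hSC hx)
    have hxCl := (Finset.mem_sdiff.1 hx1).2
    have hnear : near x < m := by simpa [Cl] using hxCl
    have hfar : n ≤ 2 * (Finset.univ.filter fun t => ¬ |(x t : ℤ) - (x₀ t : ℤ)| < p).card := by
      have := Finset.card_filter_add_card_filter_not (s := (Finset.univ : Finset (Fin n)))
        (fun t => |(x t : ℤ) - (x₀ t : ℤ)| < p)
      rw [Finset.card_univ, Fintype.card_fin] at this
      change near x + _ = n at this
      omega
    rw [← hx2]
    calc (n * p ^ 2 : ℤ) ≤ 2 * (Finset.univ.filter fun t =>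
          ¬ |(x t : ℤ) - (x₀ t : ℤ)| < p).card * p ^ 2 := by
          refine mul_le_mul_of_nonneg_right ?_ (sq_nonneg _)
          exact_mod_cast hfar
      _ = 2 * ∑ t with ¬ |(x t : ℤ) - (x₀ t : ℤ)| < p, (p : ℤ) ^ 2 := by
          rw [Finset.sum_const, nsmul_eq_mul, mul_assoc]
      _ ≤ 2 * ∑ t with ¬ |(x t : ℤ) - (x₀ t : ℤ)| < p, ((x t : ℤ) - (x₀ t : ℤ)) ^ 2 := by
          refine mul_le_mul_of_nonneg_left (Finset.sum_le_sum fun t ht => ?_) (by norm_num)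
          rw [← sq_abs ((x t : ℤ) - _)]
          exact pow_le_pow_left₀ (by positivity) (not_lt.1 (Finset.mem_filter.1 ht).2) 2
      _ ≤ 2 * N2 x := by
          refine mul_le_mul_of_nonneg_left ?_ (by norm_num)
          exact Finset.sum_le_sum_of_subset_of_nonneg (Finset.subset_univ _)
            fun _ _ _ => sq_nonneg _
  · rw [← hq']; exact (Finset.mem_Icc.1 hM).2
  · intro w hw
    obtain ⟨x, hx, rfl⟩ := Finset.mem_image.1 hw
    obtain ⟨hx1, hx2⟩ := Finset.mem_filter.1 (hSC hx)
    have hxf := (Finset.mem_filter.1 (Finset.mem_sdiff.1 hx1).1).2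
    have hx₀f := (Finset.mem_filter.1 hx₀).2
    refine ⟨fun t => by rw [← hq']; exact hdiff x t, fun k hk => ?_, hx2⟩
    have := congrFun (hxf.trans hx₀f.symm) ⟨k, hk⟩
    simp only [f] at this
    simp only [e, sub_mul, Finset.sum_sub_distrib]
    exact sub_eq_zero.2 this
  · intro w hw w' hw' hne
    obtain ⟨x, hx, rfl⟩ := Finset.mem_image.1 hw
    obtain ⟨y, hy, rfl⟩ := Finset.mem_image.1 hw'
    have hxy := hsep x hx y hy fun h => hne (h ▸ rfl)
    have hcard := Finset.card_filter_add_card_filter_not (s := (Finset.univ : Finset (Fin n)))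
      (fun t => x t = y t)
    rw [Finset.card_univ, Fintype.card_fin] at hcard
    have hh' : h ≤ (Finset.univ.filter fun t => ¬ x t = y t).card := by omega
    calc (h : ℤ) ≤ (Finset.univ.filter fun t => ¬ x t = y t).card := by exact_mod_cast hh'
      _ = ∑ t with ¬ x t = y t, (1 : ℤ) := by simp
      _ ≤ ∑ t with ¬ x t = y t, (e x t - e y t) ^ 2 := by
          refine Finset.sum_le_sum fun t ht => ?_
          have hne' : e x t - e y t ≠ 0 := by
            simp only [e, sub_sub_sub_cancel_right]
            rw [sub_ne_zero]
            intro hc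
            exact (Finset.mem_filter.1 ht).2 (Fin.ext (by exact_mod_cast hc))
          have := sq_pos_of_ne_zero hne'
          omega
      _ ≤ _ := Finset.sum_le_sum_of_subset_of_nonneg (Finset.subset_univ _)
            fun _ _ _ => sq_nonneg _
  · rw [Finset.card_image_of_injective _ he]
    exact htotal

/-! ### Asymptotics of a single layer -/

lemma tendsto_log_natCast_atTop : Tendsto (fun n : ℕ => Real.log n) atTop atTop :=
  Real.tendsto_log_atTop.comp tendsto_natCast_atTop_atTop

lemma tendsto_log_log_natCast_atTop :
    Tendsto (fun n : ℕ => Real.log (Real.log n)) atTop atTop :=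
  Real.tendsto_log_atTop.comp tendsto_log_natCast_atTop

lemma eventually_mul_log_le_rpow (C : ℝ) {b : ℝ} (hb : 0 < b) :
    ∀ᶠ n : ℕ in atTop, C * Real.log n ≤ (n : ℝ) ^ b := by
  have h := ((isLittleO_log_rpow_atTop hb).bound (by positivity : 0 < 1 / (|C| + 1)))
  filter_upwards [tendsto_natCast_atTop_atTop.eventually h, eventually_ge_atTop 1] with n hn h1
  have h1' : (1 : ℝ) ≤ n := by exact_mod_cast h1
  have hl := Real.log_nonneg h1'
  rw [Real.norm_of_nonneg hl, Real.norm_of_nonneg (by positivity), one_div_mul_eq_div,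
    le_div_iff₀ (by positivity)] at hn
  nlinarith [le_abs_self C]

/-- Number of children of a point in a layer of radius of order `n ^ b`. -/
def layerSize (b : ℝ) (n : ℕ) : ℕ :=
  ⌈Real.exp (b / 2 * (n * Real.log n) - 2 * (n * Real.log (Real.log n)))⌉₊

/-- In logarithms, `n log q` supplies the main term minus `n log log n`. The Hamming ball costs only
`O(n)` because `h` is about `n / log n`, and the labels cost `O(log n)`. The second `n log log n` in
`layerSize` absorbs these losses and the constant `80`. -/
lemma layer_card_bound {n q h L c : ℕ} {b : ℝ} (hn : 3 ≤ n) (hl1 : 1 ≤ Real.log n) (hq : 1 ≤ q)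
    (hqn : q ≤ n) (hql : (n : ℝ) ^ (b / 2) / (80 * Real.log n) ≤ q)
    (hh : (h : ℝ) ≤ n / Real.log n + 1) (hL : (4 * L + 5) * Real.log n ≤ n)
    (hll : Real.log 80 + 4 ≤ Real.log (Real.log n))
    (hc : q ^ n ≤ c * (2 * (2 * n ^ 3 + 1) ^ L * (n * q ^ 2 + 1) * (2 ^ n * q ^ h))) :
    layerSize b n ≤ c := by
  have hn' : (3 : ℝ) ≤ n := by exact_mod_cast hn
  have hq' : (1 : ℝ) ≤ q := by exact_mod_cast hq
  have hqn' : (q : ℝ) ≤ n := by exact_mod_cast hqn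
  have hc0 : 0 < c := by
    by_contra h0
    obtain rfl : c = 0 := by omega
    have : 0 < q ^ n := by positivity
    omega
  have hc0' : (0 : ℝ) < c := by exact_mod_cast hc0
  have hcR : (q : ℝ) ^ n ≤
      c * (2 * ((n : ℝ) ^ 4) ^ L * n ^ 4 * (2 ^ n * q ^ h)) := by
    have h1 : (q : ℝ) ^ n ≤
      c * (2 * (2 * n ^ 3 + 1) ^ L * (n * q ^ 2 + 1) * (2 ^ n * q ^ h)) := by exact_mod_cast hc
    have h2 : 2 * (n : ℝ) ^ 3 + 1 ≤ n ^ 4 := by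
      have : (27 : ℝ) ≤ n ^ 3 := by
        calc (27 : ℝ) = 3 ^ 3 := by norm_num
          _ ≤ _ := pow_le_pow_left₀ (by norm_num) hn' 3
      nlinarith
    have h3 : (n : ℝ) * q ^ 2 + 1 ≤ n ^ 4 := by
      have : (n : ℝ) * q ^ 2 ≤ n * n ^ 2 := by gcongr
      nlinarith [pow_pos (by linarith : (0 : ℝ) < n) 3]
    refine h1.trans ?_
    gcongr
  have hlog := Real.log_le_log (by positivity) hcR
  have hn0 : (n : ℝ) ≠ 0 := by positivity
  have hq0 : (q : ℝ) ≠ 0 := by positivity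
  rw [Real.log_mul (by positivity) (by positivity), Real.log_mul (by positivity) (by positivity),
    Real.log_mul (by positivity) (by positivity), Real.log_mul (by positivity) (by positivity),
    Real.log_mul (by positivity) (by positivity), Real.log_pow, Real.log_pow, Real.log_pow,
    Real.log_pow, Real.log_pow] at hlog
  push_cast at hlog
  have hlq : b / 2 * Real.log n - Real.log 80 - Real.log (Real.log n) ≤ Real.log q := by
    have := Real.log_le_log (by positivity) hql
    rw [Real.log_div (by positivity) (by positivity), Real.log_rpow (by positivity),
      Real.log_mul (by norm_num) (by positivity)] at this
    linarith
  have hhq : h * Real.log q ≤ n + Real.log n := by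
    calc h * Real.log q ≤ (n / Real.log n + 1) * Real.log n :=
          mul_le_mul hh (Real.log_le_log (by positivity) hqn') (Real.log_nonneg hq')
            (by positivity)
      _ = n + Real.log n := by field_simp
  have hnq := mul_le_mul_of_nonneg_left hlq (by positivity : (0 : ℝ) ≤ n)
  have hnl := mul_le_mul_of_nonneg_left hll (by positivity : (0 : ℝ) ≤ n)
  have h2 : Real.log 2 ≤ 1 := by linarith [Real.log_two_lt_d9]
  have hn2 := mul_le_mul_of_nonneg_left h2 (by positivity : (0 : ℝ) ≤ n)
  refine Nat.ceil_le.2 ?_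
  rw [← Real.le_log_iff_exp_le hc0']
  nlinarith

/-- In a given layer, below any history of integer displacements. -/
lemma eventually_exists_layer {A δ : ℝ} (hA : 0 < A) (hδ0 : 0 < δ) (hδ1 : δ < 1) {L : ℕ}
    (hL : 1 ≤ L) (ℓ : ℕ) :
    ∀ᶠ n : ℕ in atTop, ∀ z : ℕ → Fin n → ℤ, (∀ k t, |z k t| ≤ n) →
      ∃ (f : ℕ → Fin n → ℤ) (M : ℝ), 0 < M ∧
        (∀ a < layerSize ((1 - δ) / 2 ^ (ℓ + 1)) n, (∀ t, |f a t| ≤ n) ∧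
          (∀ k < L, ∑ t, f a t * z k t = 0) ∧ ∑ t, (f a t : ℝ) ^ 2 = M ∧
          ∀ t, A * (n : ℝ) ^ ((1 - δ) / 2 ^ (ℓ + 1)) / √M * |(f a t : ℝ)| ≤ A / (2 * L)) ∧
        ∀ a < layerSize ((1 - δ) / 2 ^ (ℓ + 1)) n, ∀ b < layerSize ((1 - δ) / 2 ^ (ℓ + 1)) n,
          a ≠ b → 3 * A * Real.log n * (2 * M) ≤
            A * (n : ℝ) ^ ((1 - δ) / 2 ^ (ℓ + 1)) * ∑ t, ((f a t : ℝ) - f b t) ^ 2 := by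
  set β := (1 - δ) / 2 ^ (ℓ + 1) with hβ
  have hβ0 : 0 < β := div_pos (by linarith) (by positivity)
  have hβ1 : 2 * β ≤ 1 - δ := by
    have h1 : β ≤ (1 - δ) / 2 := by
      refine div_le_div_of_nonneg_left (by linarith) (by norm_num) ?_
      exact le_self_pow₀ (by norm_num) (by omega)
    linarith
  have hL' : (1 : ℝ) ≤ L := by exact_mod_cast hL
  filter_upwards [tendsto_log_natCast_atTop.eventually_ge_atTop 1,
    tendsto_log_log_natCast_atTop.eventually_ge_atTop (Real.log 80 + 4),
    eventually_mul_log_le_rpow 80 (half_pos hβ0),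
    eventually_mul_log_le_rpow (8 * (4 * L + 5)) one_pos,
    eventually_mul_log_le_rpow (8192 * L ^ 2) hδ0,
    eventually_ge_atTop 3] with n hl1 hll hpow hlin hδn hn3 z hz
  have hn' : (3 : ℝ) ≤ n := by exact_mod_cast hn3
  have hn0 : (0 : ℝ) < n := by linarith
  rw [Real.rpow_one] at hlin
  set l := Real.log n with hldef
  have hl0 : 0 < l := by linarith
  set X := (n : ℝ) ^ (β / 2) / (80 * l)
  have hX1 : 1 ≤ X := (one_le_div (by positivity)).2 hpow
  set p := ⌊X⌋₊
  have hp : 1 ≤ p := Nat.le_floor (by exact_mod_cast hX1)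
  have hp' : (1 : ℝ) ≤ p := by exact_mod_cast hp
  have hpX : (p : ℝ) ≤ X := Nat.floor_le (by linarith)
  have hXp : X < p + 1 := Nat.lt_floor_add_one X
  have hX80 : X * (80 * l) = (n : ℝ) ^ (β / 2) := by
    simp only [X]; field_simp
  have hqn : 32 * p ≤ n := by
    have h1 : (n : ℝ) ^ (β / 2) ≤ n := by
      conv_rhs => rw [← Real.rpow_one n]
      exact Real.rpow_le_rpow_of_exponent_le (by linarith) (by linarith)
    have : (32 : ℝ) * p ≤ n := by nlinarith
    exact_mod_cast this
  set h := ⌈(n : ℝ) / l⌉₊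
  have hhn : h ≤ n := Nat.ceil_le.2 (div_le_self hn0.le hl1)
  have hh1 : (n : ℝ) / l ≤ h := Nat.le_ceil _
  have hh2 : (h : ℝ) ≤ n / l + 1 := (Nat.ceil_lt_add_one (by positivity)).le
  have hlab : 2 * (2 * n ^ 3 + 1) ^ L ≤ 2 ^ n := by
    have h2 : 2 * (n : ℝ) ^ 3 + 1 ≤ n ^ 4 := by
      have : (27 : ℝ) ≤ n ^ 3 := by
        calc (27 : ℝ) = 3 ^ 3 := by norm_num
          _ ≤ _ := pow_le_pow_left₀ (by norm_num) hn' 3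
      nlinarith
    have : (2 : ℝ) * (2 * n ^ 3 + 1) ^ L ≤ 2 ^ n := by
      calc (2 : ℝ) * (2 * n ^ 3 + 1) ^ L ≤ n * (n ^ 4) ^ L := by gcongr; linarith
        _ = Real.exp ((4 * L + 1) * l) := by
            rw [← pow_mul, mul_comm, ← pow_succ, ← Real.exp_log hn0, ← Real.exp_nat_mul]
            push_cast; rfl
        _ ≤ Real.exp (n * Real.log 2) := by
            refine Real.exp_le_exp.2 ?_
            nlinarith [Real.log_two_gt_d9]
        _ = 2 ^ n := by rw [Real.exp_nat_mul, Real.exp_log (by norm_num)]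
    exact_mod_cast this
  obtain ⟨S, M, hM1, hM2, hS, hsep, hcard⟩ := exists_separated_orthogonal z hz hp hqn hhn hlab
  have hsize : layerSize β n ≤ S.card := by
    refine layer_card_bound hn3 hl1 (by omega) hqn ?_ hh2 ?_ hll hcard
    · push_cast
      change X ≤ _
      linarith
    · nlinarith
  have hM1' : (n : ℝ) * p ^ 2 ≤ 2 * M := by exact_mod_cast hM1
  have hM2' : (M : ℝ) ≤ n * (32 * p) ^ 2 := by exact_mod_cast hM2
  have hM0 : (0 : ℝ) < M := by
    have : (0 : ℝ) < n * p ^ 2 := by positivity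
    linarith
  -- An enumeration of `S` by natural numbers, with the junk value `0` beyond its cardinality.
  obtain ⟨f, hf⟩ : ∃ f : ℕ → Fin n → ℤ, ∀ a, ∀ h : a < S.card,
      f a = (S.equivFin.symm ⟨a, h⟩ : Fin n → ℤ) :=
    ⟨fun a => if h : a < S.card then (S.equivFin.symm ⟨a, h⟩ : Fin n → ℤ) else 0,
      fun a h => by simp [h]⟩
  have hfS : ∀ a < layerSize β n, f a ∈ S := fun a ha => by
    rw [hf a (ha.trans_le hsize)]; exact (S.equivFin.symm _).2
  refine ⟨f, M, hM0, fun a ha => ?_, fun a ha b hb hab => ?_⟩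
  · obtain ⟨h1, h2, h3⟩ := hS _ (hfS a ha)
    refine ⟨fun t => (h1 t).trans (by exact_mod_cast hqn), h2, by exact_mod_cast h3, fun t => ?_⟩
    have h1' : |(f a t : ℝ)| ≤ 32 * p := by exact_mod_cast h1 t
    -- Since `M ≥ n p² / 2`, it suffices that `8192 L² n^(2β) ≤ n`, which `2β ≤ 1 - δ` makes true
    -- for large `n`. Each layer then moves a coordinate by at most `A / (2L)`.
    have hkey : 64 * L * (n : ℝ) ^ β * p ≤ √M := by
      refine Real.le_sqrt_of_sq_le ?_
      have e1 : ((n : ℝ) ^ β) ^ 2 * (8192 * L ^ 2) ≤ n := by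
        calc ((n : ℝ) ^ β) ^ 2 * (8192 * L ^ 2) ≤ (n : ℝ) ^ (1 - δ) * (n : ℝ) ^ δ := by
              gcongr
              · rw [← Real.rpow_natCast, ← Real.rpow_mul hn0.le]
                exact Real.rpow_le_rpow_of_exponent_le (by linarith) (by push_cast; linarith)
              · nlinarith [sq_nonneg (L : ℝ)]
          _ = n := by rw [← Real.rpow_add hn0]; simp
      have e2 := mul_le_mul_of_nonneg_right e1 (sq_nonneg (p : ℝ))
      nlinarith
    have hsq : 0 < √(M : ℝ) := Real.sqrt_pos.2 hM0
    rw [div_mul_eq_mul_div, div_le_div_iff₀ hsq (by positivity)]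
    calc A * (n : ℝ) ^ β * |(f a t : ℝ)| * (2 * L) ≤ A * (n : ℝ) ^ β * (32 * p) * (2 * L) := by
          gcongr
      _ = A * (64 * L * (n : ℝ) ^ β * p) := by ring
      _ ≤ A * √M := by gcongr
  · have hne : f a ≠ f b := by
      rw [hf a (ha.trans_le hsize), hf b (hb.trans_le hsize)]
      intro he
      have := S.equivFin.symm.injective (Subtype.ext he)
      exact hab (by simpa using this)
    have h1 : (h : ℝ) ≤ ∑ t, ((f a t : ℝ) - f b t) ^ 2 := by
      exact_mod_cast hsep _ (hfS a ha) _ (hfS b hb) hne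
    have hpl : (p * (80 * l)) ^ 2 ≤ (n : ℝ) ^ β := by
      calc (p * (80 * l)) ^ 2 ≤ (X * (80 * l)) ^ 2 := by gcongr
        _ = (n : ℝ) ^ β := by
            rw [hX80, ← Real.rpow_natCast, ← Real.rpow_mul hn0.le]; congr 1; push_cast; ring
    have h2 : n ≤ l * ∑ t, ((f a t : ℝ) - f b t) ^ 2 := by
      have := (div_le_iff₀ hl0).1 (hh1.trans h1)
      linarith
    set D := ∑ t, ((f a t : ℝ) - f b t) ^ 2
    have hD : 0 ≤ D := Finset.sum_nonneg fun t _ => sq_nonneg _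
    -- The constant `80` in the box size is needed here: `6 · 32² = 6144 ≤ 6400 = 80²`.
    calc 3 * A * l * (2 * M) ≤ 3 * A * l * (2 * (n * (32 * p) ^ 2)) := by gcongr
      _ ≤ 3 * A * l * (2 * (l * D * (32 * p) ^ 2)) := by gcongr
      _ = A * (6144 * (p * l) ^ 2) * D := by ring
      _ ≤ A * (n : ℝ) ^ β * D := by
          refine mul_le_mul_of_nonneg_right (mul_le_mul_of_nonneg_left ?_ hA.le) hD
          refine le_trans ?_ hpl
          have := sq_nonneg ((p : ℝ) * l)
          linarith [show ((p : ℝ) * (80 * l)) ^ 2 = 6400 * (p * l) ^ 2 by ring]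

/-! ### The code book -/

/-- The code book with given displacements. -/
def PrimitiveCodebook.ofDisp {n L : ℕ} (c : EuclideanSpace ℝ (Fin n)) (r : Fin L → ℝ) (d : ℝ)
    (size : Fin L → ℕ) (v : (∀ ℓ : Fin L, Fin (size ℓ)) → Fin L → EuclideanSpace ℝ (Fin n))
    (hcongr : ∀ s s' ℓ, (∀ k ≤ ℓ, s k = s' k) → v s ℓ = v s' ℓ)
    (horth : ∀ s k ℓ, k < ℓ → inner ℝ (v s k) (v s ℓ) = 0)
    (hdense : ∀ s ℓ, IsAngleDense d (r ℓ) fun a : Fin (size ℓ) => v (Function.update s ℓ a) ℓ) :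
    PrimitiveCodebook n L c r d :=
  have hdisp : ∀ (s : ∀ ℓ : Fin L, Fin (size ℓ)) (ℓ : Fin L),
      (c + ∑ k : Fin L with k.val < ℓ.succ.val, v s k) -
        (c + ∑ k : Fin L with k.val < ℓ.castSucc.val, v s k) = v s ℓ := by
    intro s ℓ
    have h1 : (Finset.univ.filter fun k : Fin L => k.val < ℓ.succ.val) =
        insert ℓ (Finset.univ.filter fun k : Fin L => k.val < ℓ.castSucc.val) := by
      ext k
      simp only [Finset.mem_filter, Finset.mem_univ, true_and, Finset.mem_insert, Fin.ext_iff,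
        Fin.val_succ, Fin.val_castSucc]
      omega
    rw [h1, Finset.sum_insert (by simp)]
    abel
  { size := size
    point := fun s m => c + ∑ k : Fin L with k.val < m.val, v s k
    point_zero := fun s => by simp
    point_congr := fun s s' m h => by
      congr 1
      refine Finset.sum_congr rfl fun k hk => hcongr s s' k fun j hj => h j ?_
      exact lt_of_le_of_lt hj (Finset.mem_filter.1 hk).2
    orthogonal := fun s k ℓ hkl => by
      rw [hdisp, hdisp]
      rcases lt_or_gt_of_ne hkl with h | h
      · exact horth s k ℓ h
      · rw [real_inner_comm]; exact horth s ℓ k h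
    angleDense := fun s ℓ => by
      simp only [hdisp]
      exact hdense s ℓ }

lemma PrimitiveCodebook.word_ofDisp {n L : ℕ} {c : EuclideanSpace ℝ (Fin n)} {r : Fin L → ℝ}
    {d : ℝ} {size : Fin L → ℕ} {v : (∀ ℓ : Fin L, Fin (size ℓ)) → Fin L → EuclideanSpace ℝ (Fin n)}
    {hcongr} {horth} {hdense} (s : ∀ ℓ : Fin L, Fin (size ℓ)) :
    (PrimitiveCodebook.ofDisp c r d size v hcongr horth hdense).word s = c + ∑ k, v s k := by
  simp [PrimitiveCodebook.word, PrimitiveCodebook.ofDisp]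

/-- The vectors along the address `a`, when `F` selects a vector from the layer, the earlier
vectors, and the letter. -/
def branch {V : Type*} [Zero V] (F : ℕ → (ℕ → V) → ℕ → V) (a : ℕ → ℕ) (m : ℕ) : V :=
  F m (fun k => if _h : k < m then branch F a k else 0) (a m)
termination_by m

/-- The vectors along the address `a` that precede layer `m`. -/
def history {V : Type*} [Zero V] (F : ℕ → (ℕ → V) → ℕ → V) (a : ℕ → ℕ) (m : ℕ) : ℕ → V :=
  fun k => if k < m then branch F a k else 0

lemma branch_eq {V : Type*} [Zero V] (F : ℕ → (ℕ → V) → ℕ → V) (a : ℕ → ℕ) (m : ℕ) :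
    branch F a m = F m (history F a m) (a m) := by
  rw [branch]; simp only [dite_eq_ite]; rfl

lemma branch_congr {V : Type*} [Zero V] (F : ℕ → (ℕ → V) → ℕ → V) {a b : ℕ → ℕ} {m : ℕ}
    (h : ∀ k ≤ m, a k = b k) : branch F a m = branch F b m := by
  induction m using Nat.strong_induction_on with
  | _ m ih =>
    rw [branch_eq, branch_eq, h m le_rfl]
    congr 1
    funext k
    unfold history
    split_ifs with hk
    · exact ih k hk fun j hj => h j (hj.trans hk.le)
    · rfl

lemma history_congr {V : Type*} [Zero V] (F : ℕ → (ℕ → V) → ℕ → V) {a b : ℕ → ℕ} {m : ℕ}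
    (h : ∀ k < m, a k = b k) : history F a m = history F b m := by
  funext k
  unfold history
  split_ifs with hk
  · exact branch_congr F fun j hj => h j (hj.trans_lt hk)
  · rfl

/-- A finite address as a sequence of letters. -/
def extendAddress {L : ℕ} {size : Fin L → ℕ} (s : ∀ ℓ : Fin L, Fin (size ℓ)) (m : ℕ) : ℕ :=
  if h : m < L then (s ⟨m, h⟩ : ℕ) else 0

lemma extendAddress_val {L : ℕ} {size : Fin L → ℕ} (s : ∀ ℓ : Fin L, Fin (size ℓ)) (ℓ : Fin L) :
    extendAddress s ℓ = s ℓ := by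
  simp [extendAddress]

lemma extendAddress_congr {L : ℕ} {size : Fin L → ℕ} {s s' : ∀ ℓ : Fin L, Fin (size ℓ)}
    {m : ℕ} (hm : m < L) (h : s ⟨m, hm⟩ = s' ⟨m, hm⟩) :
    extendAddress s m = extendAddress s' m := by
  simp [extendAddress, hm, h]

lemma inner_toLp_intCast {n : ℕ} (x y : Fin n → ℤ) :
    inner ℝ (WithLp.toLp 2 fun t => (x t : ℝ) : EuclideanSpace ℝ (Fin n))
      (WithLp.toLp 2 fun t => (y t : ℝ)) = ∑ t, (x t : ℝ) * y t := by
  rw [PiLp.inner_apply]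
  exact Finset.sum_congr rfl fun t _ => by simp [mul_comm]

/-- For vectors of equal norm the projective gap is a squared distance: after scaling to radius `r`
it equals `r ‖f a - f b‖² / (2 M)`. -/
lemma isAngleDense_smul_intCast {n N : ℕ} {r d M : ℝ} (hr : 0 < r) (hM : 0 < M)
    {f : Fin N → Fin n → ℤ} (hf : ∀ a, ∑ t, (f a t : ℝ) ^ 2 = M)
    (hd : ∀ a b, a ≠ b → d * (2 * M) ≤ r * ∑ t, ((f a t : ℝ) - f b t) ^ 2) :
    IsAngleDense d r fun a =>
      (r / √M) • (WithLp.toLp 2 fun t => (f a t : ℝ) : EuclideanSpace ℝ (Fin n)) := by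
  have hs : 0 < √M := Real.sqrt_pos.2 hM
  have hnorm : ∀ a, ‖(r / √M) • (WithLp.toLp 2 fun t => (f a t : ℝ) :
      EuclideanSpace ℝ (Fin n))‖ = r := by
    intro a
    have : ‖(WithLp.toLp 2 fun t => (f a t : ℝ) : EuclideanSpace ℝ (Fin n))‖ = √M := by
      rw [EuclideanSpace.norm_eq, ← hf a]
      simp
    rw [norm_smul, this, Real.norm_of_nonneg (by positivity)]
    field_simp
  refine ⟨hnorm, fun a b hab => ?_⟩
  rw [norm_projOnto_sub hr (hnorm a) (hnorm b), real_inner_smul_left, real_inner_smul_right,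
    inner_toLp_intCast]
  have hD : ∑ t, ((f a t : ℝ) - f b t) ^ 2 = 2 * M - 2 * ∑ t, (f a t : ℝ) * f b t := by
    have e : ∀ t, ((f a t : ℝ) - f b t) ^ 2 =
        (f a t : ℝ) ^ 2 + (f b t : ℝ) ^ 2 - 2 * ((f a t : ℝ) * f b t) := fun t => by ring
    simp_rw [e]
    rw [Finset.sum_sub_distrib, Finset.sum_add_distrib, hf, hf, ← Finset.mul_sum]
    ring
  have h := hd a b hab
  rw [hD] at h
  have e2 : r - r / √M * (r / √M * ∑ t, (f a t : ℝ) * f b t) / r =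
      r * (2 * M - 2 * ∑ t, (f a t : ℝ) * f b t) / (2 * M) := by
    have : r / √M * (r / √M * ∑ t, (f a t : ℝ) * f b t) =
        r ^ 2 / √M ^ 2 * ∑ t, (f a t : ℝ) * f b t := by field_simp
    rw [this, Real.sq_sqrt hM.le]
    field_simp
  rw [e2, le_div_iff₀ (by positivity)]
  exact h

lemma eventually_exists_codebook {A δ : ℝ} (hA : 0 < A) (hδ0 : 0 < δ) (hδ1 : δ < 1) {L : ℕ}
    (hL : 1 ≤ L) :
    ∀ᶠ n : ℕ in atTop, ∃ B : PoissonCodebook A δ L n,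
      (∀ ℓ, B.size ℓ = layerSize ((1 - δ) / 2 ^ (ℓ.val + 1)) n) ∧
      ∀ s t, B.word s t ∈ Set.Icc (0 : ℝ) A := by
  have hlayers : ∀ᶠ n : ℕ in atTop, ∀ ℓ ∈ Finset.range L, _ :=
    (Filter.eventually_all_finset (Finset.range L)).2 fun ℓ _ =>
      eventually_exists_layer hA hδ0 hδ1 hL ℓ
  filter_upwards [hlayers, eventually_ge_atTop 1] with n hn hn1
  set N : ℕ → ℕ := fun ℓ => layerSize ((1 - δ) / 2 ^ (ℓ + 1)) n
  set r : ℕ → ℝ := fun ℓ => A * (n : ℝ) ^ ((1 - δ) / 2 ^ (ℓ + 1))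
  have hr : ∀ ℓ, 0 < r ℓ := fun ℓ => by
    have : (0 : ℝ) < n := by exact_mod_cast hn1
    positivity
  -- The hypotheses move inside the existential so that choice yields a total selector `F`, with
  -- value `0` on irrelevant histories.
  have hF : ∀ (ℓ : ℕ) (z : ℕ → Fin n → ℤ), ∃ (f : ℕ → Fin n → ℤ) (M : ℝ),
      ℓ < L → (∀ k t, |z k t| ≤ n) → 0 < M ∧
        (∀ a < N ℓ, (∀ t, |f a t| ≤ n) ∧
          (∀ k < L, ∑ t, f a t * z k t = 0) ∧ ∑ t, (f a t : ℝ) ^ 2 = M ∧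
          ∀ t, r ℓ / √M * |(f a t : ℝ)| ≤ A / (2 * L)) ∧
        ∀ a < N ℓ, ∀ b < N ℓ, a ≠ b → 3 * A * Real.log n * (2 * M) ≤
            r ℓ * ∑ t, ((f a t : ℝ) - f b t) ^ 2 := by
    intro ℓ z
    by_cases h : ℓ < L ∧ ∀ k t, |z k t| ≤ n
    · obtain ⟨f, M, hfM⟩ := hn ℓ (Finset.mem_range.2 h.1) z h.2
      exact ⟨f, M, fun _ _ => hfM⟩
    · exact ⟨0, 0, fun h1 h2 => absurd ⟨h1, h2⟩ h⟩
  choose F M hFM using hF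
  have hsN : ∀ (s : ∀ ℓ : Fin L, Fin (N ℓ)) (m : ℕ), m < L → extendAddress s m < N m := by
    intro s m hm
    rw [extendAddress, dif_pos hm]
    exact (s ⟨m, hm⟩).2
  -- Every history met along an address obeys the bound that the selector requires, because each
  -- chosen vector obeys it in turn.
  have hhist : ∀ (s : ∀ ℓ : Fin L, Fin (N ℓ)) (m : ℕ), m ≤ L →
      ∀ k t, |history F (extendAddress s) m k t| ≤ n := by
    intro s m
    induction m using Nat.strong_induction_on with
    | _ m ih =>
      intro hm k t
      unfold history
      split_ifs with hk
      · rw [branch_eq]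
        exact ((hFM k _ (hk.trans_le hm) (ih k hk (hk.le.trans hm))).2.1 _
          (hsN s k (hk.trans_le hm))).1 t
      · simp
  let v : (∀ ℓ : Fin L, Fin (N ℓ)) → Fin L → EuclideanSpace ℝ (Fin n) := fun s ℓ =>
    (r ℓ / √(M ℓ (history F (extendAddress s) ℓ))) •
      (WithLp.toLp 2 fun t => (branch F (extendAddress s) ℓ t : ℝ))
  have hcongr : ∀ s s' ℓ, (∀ k ≤ ℓ, s k = s' k) → v s ℓ = v s' ℓ := by
    intro s s' ℓ h
    have hb : ∀ k ≤ ℓ.val, extendAddress s k = extendAddress s' k := fun k hk =>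
      extendAddress_congr (hk.trans_lt ℓ.2) (h ⟨k, _⟩ hk)
    simp only [v, branch_congr F hb, history_congr F fun k hk => hb k hk.le]
  have horth : ∀ s k ℓ, k < ℓ → inner ℝ (v s k) (v s ℓ) = 0 := by
    intro s k ℓ hkl
    have h := ((hFM ℓ _ ℓ.2 (hhist s ℓ ℓ.2.le)).2.1 _ (hsN s ℓ ℓ.2)).2.1 k k.2
    rw [← branch_eq F] at h
    have hk : history F (extendAddress s) ℓ k = branch F (extendAddress s) k := if_pos hkl
    rw [hk] at h
    have h' : ∑ t, (branch F (extendAddress s) ℓ t : ℝ) * branch F (extendAddress s) k t = 0 := by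
      exact_mod_cast h
    rw [real_inner_comm, real_inner_smul_left, real_inner_smul_right, inner_toLp_intCast, h']
    simp
  have hdense : ∀ s (ℓ : Fin L), IsAngleDense (3 * A * Real.log n) (r ℓ)
      fun a : Fin (N ℓ) => v (Function.update s ℓ a) ℓ := by
    intro s ℓ
    have hv : ∀ a : Fin (N ℓ), v (Function.update s ℓ a) ℓ =
        (r ℓ / √(M ℓ (history F (extendAddress s) ℓ))) •
          (WithLp.toLp 2 fun t => (F ℓ (history F (extendAddress s) ℓ) a t : ℝ)) := by
      intro a
      have hh : history F (extendAddress (Function.update s ℓ a)) ℓ =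
          history F (extendAddress s) ℓ := by
        refine history_congr F fun k hk => extendAddress_congr (hk.trans ℓ.2) ?_
        rw [Function.update_of_ne]
        exact (Fin.lt_def.2 hk).ne
      simp only [v, branch_eq, hh, extendAddress_val, Function.update_self]
    simp only [hv]
    obtain ⟨hM, h1, h2⟩ := hFM ℓ _ ℓ.2 (hhist s ℓ ℓ.2.le)
    exact isAngleDense_smul_intCast (hr ℓ) hM (fun a => (h1 a a.2).2.2.1)
      fun a b hab => h2 a a.2 b b.2 fun h => hab (Fin.ext h)
  refine ⟨PrimitiveCodebook.ofDisp _ _ _ (fun ℓ : Fin L => N ℓ) v hcongr horth hdense,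
    fun ℓ => rfl, fun s t => ?_⟩
  suffices h : ((WithLp.toLp 2 fun _ => A / 2 : EuclideanSpace ℝ (Fin n)) + ∑ k, v s k) t ∈
      Set.Icc (0 : ℝ) A from
    (congrArg (fun x : EuclideanSpace ℝ (Fin n) => x t ∈ Set.Icc (0 : ℝ) A)
      (PrimitiveCodebook.word_ofDisp s)).mpr h
  have hL' : (0 : ℝ) < L := by exact_mod_cast hL
  -- The `L` layers together move a coordinate from the centre `A / 2` by at most `A / 2`; no word
  -- leaves the cube, so expurgation removes nothing.
  have hsum : |(∑ k, v s k) t| ≤ A / 2 := by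
    rw [WithLp.ofLp_sum, Finset.sum_apply]
    calc |∑ k, v s k t| ≤ ∑ k, |v s k t| := Finset.abs_sum_le_sum_abs _ _
      _ ≤ ∑ _k : Fin L, A / (2 * L) := by
          refine Finset.sum_le_sum fun k _ => ?_
          obtain ⟨hM, h1, -⟩ := hFM k _ k.2 (hhist s k k.2.le)
          have := (h1 _ (hsN s k k.2)).2.2.2 t
          rw [← branch_eq F] at this
          simp only [v, PiLp.smul_apply, smul_eq_mul]
          rw [abs_mul, abs_of_nonneg (div_nonneg (hr k).le (Real.sqrt_nonneg _))]
          exact this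
      _ = A / 2 := by
          simp only [Finset.sum_const, Finset.card_univ, Fintype.card_fin, nsmul_eq_mul]
          field_simp
  obtain ⟨h1, h2⟩ := abs_le.1 hsum
  rw [PiLp.add_apply]
  simp only [Set.mem_Icc]
  constructor <;> linarith

/-! ### Rates -/

lemma log_layerSize_ge (b : ℝ) (n : ℕ) :
    b / 2 * (n * Real.log n) - 2 * (n * Real.log (Real.log n)) ≤ Real.log (layerSize b n) := by
  have h := Nat.le_ceil (Real.exp (b / 2 * (n * Real.log n) - 2 * (n * Real.log (Real.log n))))
  exact (Real.le_log_iff_exp_le ((Real.exp_pos _).trans_le h)).2 h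

lemma layerSize_pos (b : ℝ) (n : ℕ) : 0 < layerSize b n := Nat.ceil_pos.2 (Real.exp_pos _)

lemma eventually_exists_large_codebook {A δ : ℝ} (hA : 0 < A) (hδ0 : 0 < δ) (hδ1 : δ < 1) {L : ℕ}
    (hL : 1 ≤ L) :
    ∀ᶠ n : ℕ in atTop, ∃ B : PoissonCodebook A δ L n,
      n * Real.log n / 2 * (∑ ℓ ∈ Finset.Icc 1 L, (1 - δ) / 2 ^ ℓ)
        - 2 * L * (n * Real.log (Real.log n)) ≤ Real.log (Nat.card (B.Message A)) := by
  filter_upwards [eventually_exists_codebook hA hδ0 hδ1 hL] with n ⟨B, hsize, hword⟩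
  refine ⟨B, ?_⟩
  have hcard : Nat.card (B.Message A) =
      ∏ ℓ : Fin L, layerSize ((1 - δ) / 2 ^ (ℓ.val + 1)) n := by
    rw [Nat.card_congr (Equiv.subtypeUnivEquiv (hword ·)), Nat.card_eq_fintype_card,
      Fintype.card_pi]
    exact Finset.prod_congr rfl fun ℓ _ => by rw [Fintype.card_fin, hsize]
  have hsum : ∑ ℓ ∈ Finset.Icc 1 L, (1 - δ) / 2 ^ ℓ =
      ∑ ℓ : Fin L, (1 - δ) / 2 ^ (ℓ.val + 1) := by
    rw [Fin.sum_univ_eq_sum_range (fun ℓ => (1 - δ) / 2 ^ (ℓ + 1)), Finset.range_eq_Ico,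
      Finset.sum_Ico_add' (fun ℓ => (1 - δ) / 2 ^ ℓ) 0 L 1]
    rfl
  rw [hcard, Nat.cast_prod, Real.log_prod fun ℓ _ => by
    have := layerSize_pos ((1 - δ) / 2 ^ (ℓ.val + 1)) n
    positivity, hsum]
  refine le_trans (le_of_eq ?_) (Finset.sum_le_sum fun ℓ _ => log_layerSize_ge _ n)
  rw [Finset.sum_sub_distrib, ← Finset.sum_mul, ← Finset.sum_div]
  simp only [Finset.sum_const, Finset.card_univ, Fintype.card_fin, nsmul_eq_mul]
  ring

lemma sum_Icc_div_two_pow (c : ℝ) (L : ℕ) :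
    ∑ ℓ ∈ Finset.Icc 1 L, c / 2 ^ ℓ = c * (1 - 1 / 2 ^ L) := by
  induction L with
  | zero => simp
  | succ L ih =>
    rw [Finset.sum_Icc_succ_top (by omega), ih]
    field_simp
    ring

lemma exists_codebook_rate_ge {A ε : ℝ} (hA : 0 < A) (hε : 0 < ε) :
    ∃ (L : ℕ) (δ : ℝ), 1 ≤ L ∧ 0 < δ ∧ δ < 1 ∧
      ∀ᶠ n : ℕ in atTop, ∃ B : PoissonCodebook A δ L n,
        1 / 2 - ε ≤ Real.log (Nat.card (B.Message A)) / (n * Real.log n) := by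
  obtain ⟨L₀, hL₀⟩ := exists_pow_lt_of_lt_one hε (by norm_num : (1 / 2 : ℝ) < 1)
  set L := L₀ + 1
  set δ := min ε (1 / 2)
  have hδ0 : 0 < δ := lt_min hε (by norm_num)
  have hδ1 : δ < 1 := (min_le_right _ _).trans_lt (by norm_num)
  have hδε : δ ≤ ε := min_le_left _ _
  refine ⟨L, δ, by omega, hδ0, hδ1, ?_⟩
  have hLε : 1 / (2 : ℝ) ^ L ≤ ε / 2 := by
    rw [← one_div_pow, pow_succ]; linarith
  have hll : ∀ᶠ n : ℕ in atTop, 8 * L / ε * Real.log (Real.log n) ≤ Real.log n := by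
    have h := Real.isLittleO_log_id_atTop.bound (by positivity : 0 < ε / (8 * L + 1))
    filter_upwards [tendsto_log_natCast_atTop.eventually h,
      tendsto_log_natCast_atTop.eventually_ge_atTop 1] with n hn h1
    rw [id, Real.norm_of_nonneg (Real.log_nonneg h1), Real.norm_of_nonneg (by linarith),
      div_mul_eq_mul_div, le_div_iff₀ (by positivity)] at hn
    rw [div_mul_eq_mul_div, div_le_iff₀ hε]
    nlinarith [Real.log_nonneg h1]
  filter_upwards [eventually_exists_large_codebook hA hδ0 hδ1 (by omega : 1 ≤ L), hll,
    tendsto_log_natCast_atTop.eventually_gt_atTop 0, eventually_gt_atTop 0] with n ⟨B, hB⟩ hn hl hn0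
  refine ⟨B, ?_⟩
  have hn0' : (0 : ℝ) < n := by exact_mod_cast hn0
  rw [le_div_iff₀ (by positivity)]
  refine le_trans ?_ hB
  rw [sum_Icc_div_two_pow]
  -- With `δ ≤ ε` and `2^(-L) ≤ ε / 2` the product loses at most `3ε / 2`, hence the rate `3ε / 4`;
  -- the remaining `ε / 4` pays for the `log log` term.
  have h1 : 1 - 2 * ε + ε / 2 ≤ (1 - δ) * (1 - 1 / 2 ^ L) := by
    have : 0 < 1 / (2 : ℝ) ^ L := by positivity
    nlinarith
  have h2 : 2 * L * Real.log (Real.log n) ≤ ε / 4 * Real.log n := by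
    rw [div_mul_eq_mul_div, div_le_iff₀ hε] at hn
    linarith
  have h3 := mul_le_mul_of_nonneg_left h1 (by positivity : 0 ≤ n * Real.log n / 2)
  have h4 := mul_le_mul_of_nonneg_left h2 hn0'.le
  linarith

lemma IsDICode.comp {X Y ι κ : Type*} [MeasurableSpace Y] {n : ℕ} {W : X → ProbabilityMeasure Y}
    {u : ι → Fin n → X} {D : ι → Set (Fin n → Y)} {l₁ l₂ : ℝ} (h : IsDICode W u D l₁ l₂)
    {e : κ → ι} (he : Function.Injective e) : IsDICode W (u ∘ e) (D ∘ e) l₁ l₂ :=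
  ⟨h.pos₁, h.pos₂, fun i => h.measurable (e i), fun i => h.missed (e i),
    fun _ _ hij => h.false_id _ _ (he.ne hij)⟩

lemma IsDICode.mono {X Y ι : Type*} [MeasurableSpace Y] {n : ℕ} {W : X → ProbabilityMeasure Y}
    {u : ι → Fin n → X} {D : ι → Set (Fin n → Y)} {l₁ l₂ l₁' : ℝ} (h : IsDICode W u D l₁ l₂)
    (hl : l₁ ≤ l₁') : IsDICode W u D l₁' l₂ :=
  ⟨h.pos₁.trans_le hl, h.pos₂, h.measurable, fun i => (sub_le_sub_left hl 1).trans (h.missed i),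
    h.false_id⟩

lemma poissonError_le_mul {A : ℝ} {L : ℕ} (hL : 1 ≤ L) (n : ℕ) :
    poissonError A n ≤ L * poissonError A n :=
  le_mul_of_one_le_left (Real.exp_pos _).le (by exact_mod_cast hL)

lemma tendsto_poissonError {A : ℝ} (hA : 0 < A) : Tendsto (poissonError A) atTop (𝓝 0) := by
  refine Real.tendsto_exp_atBot.comp ?_
  refine Tendsto.const_mul_atBot (by positivity) ?_
  exact tendsto_atBot_add_const_left _ _ (tendsto_neg_atBot_iff.2 tendsto_log_natCast_atTop)

lemma tendsto_mul_log_natCast_atTop :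
    Tendsto (fun n : ℕ => (n : ℝ) * Real.log n) atTop atTop :=
  tendsto_natCast_atTop_atTop.atTop_mul_atTop₀ tendsto_log_natCast_atTop

lemma eventually_existsDICode_rate_ge {A ε : ℝ} (hA : 0 < A) (hε : 0 < ε) :
    ∀ᶠ n : ℕ in atTop, ∃ N : ℕ,
      ExistsDICode (poissonChannel A) n N (poissonError A n) (poissonError A n) ∧
      (1 / 2 - ε) * (n * Real.log n) ≤ Real.log N := by
  obtain ⟨L, δ, -, -, hδ1, h⟩ := exists_codebook_rate_ge hA hε
  filter_upwards [h, eventually_isDICode hA L hδ1,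
    tendsto_mul_log_natCast_atTop.eventually_gt_atTop 0] with n ⟨B, hB⟩ hcode hn
  refine ⟨Nat.card (B.Message A),
    ⟨_, _, (hcode B).comp (Finite.equivFin (B.Message A)).symm.injective⟩, ?_⟩
  rwa [le_div_iff₀ hn] at hB

open Classical in
/-- The largest size, up to `n ^ (n / 2)`, of a code with both errors at most `poissonError A n`. -/
def optimalSize (A : ℝ) (n : ℕ) : ℕ :=
  Nat.findGreatest
    (fun N => ExistsDICode (poissonChannel A) n N (poissonError A n) (poissonError A n))
    ⌊Real.exp (n * Real.log n / 2)⌋₊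

lemma existsDICode_optimalSize (A : ℝ) (n : ℕ) :
    ExistsDICode (poissonChannel A) n (optimalSize A n) (poissonError A n) (poissonError A n) := by
  classical
  refine Nat.findGreatest_spec
    (P := fun N => ExistsDICode (poissonChannel A) n N (poissonError A n) (poissonError A n))
    -- The empty code makes the search succeed at every block length, including small ones.
    (Nat.zero_le _) ⟨Fin.elim0, Fin.elim0, ?_⟩
  exact ⟨Real.exp_pos _, Real.exp_pos _, fun i => i.elim0, fun i => i.elim0, fun i => i.elim0⟩

/-- The cap `n ^ (n / 2)` gives the upper limit without the converse. For the lower limit, any code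
of rate at least `1/2 - ε` may be cut down to the cap, and the rounding of the cap costs only a
constant in the logarithm. -/
lemma tendsto_rate_optimalSize {A : ℝ} (hA : 0 < A) :
    Tendsto (fun n : ℕ => Real.log (optimalSize A n) / (n * Real.log n)) atTop (𝓝 (1 / 2)) := by
  refine tendsto_order.2 ⟨fun a ha => ?_, fun a ha => ?_⟩
  · set ε := (1 / 2 - a) / 2
    have hε : 0 < ε := by simp only [ε]; linarith
    filter_upwards [eventually_existsDICode_rate_ge hA hε,
      tendsto_mul_log_natCast_atTop.eventually_gt_atTop 2,
      (tendsto_mul_log_natCast_atTop.const_mul_atTop hε).eventually_ge_atTop 1]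
      with n ⟨N₀, ⟨u, D, hN₀⟩, hrate⟩ hn hn'
    set x := (n : ℝ) * Real.log n
    set F := ⌊Real.exp (x / 2)⌋₊
    have hFle : min N₀ F ≤ optimalSize A n := by
      classical
      refine Nat.le_findGreatest (min_le_right _ _) ?_
      exact ⟨_, _, hN₀.comp (Fin.castLE_injective (min_le_left N₀ F))⟩
    have hF : (1 / 2 - ε) * x ≤ Real.log F := by
      have h2 : 2 ≤ Real.exp (x / 2) := by linarith [Real.add_one_le_exp (x / 2)]
      have h3 : Real.exp (x / 2) / 2 ≤ F := by
        have := Nat.lt_floor_add_one (Real.exp (x / 2))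
        change _ < (F : ℝ) + 1 at this
        linarith
      have h4 := Real.log_le_log (by positivity) h3
      rw [Real.log_div (by positivity) (by norm_num), Real.log_exp] at h4
      linarith [Real.log_two_lt_d9]
    have hmin : (1 / 2 - ε) * x ≤ Real.log (min N₀ F : ℕ) := by
      rcases min_choice N₀ F with h | h <;> rw [h] <;> assumption
    have hx0 : 0 < x := by linarith
    have ha' : a < 1 / 2 - ε := by simp only [ε]; linarith
    rw [lt_div_iff₀ hx0]
    rcases Nat.eq_zero_or_pos (min N₀ F) with h0 | h0
    · have : (1 / 2 - ε) * x ≤ 0 := by simpa [h0] using hmin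
      have hlog : 0 ≤ Real.log (optimalSize A n) := Real.log_natCast_nonneg _
      nlinarith
    · have := Real.log_le_log (by exact_mod_cast h0) (Nat.cast_le (α := ℝ).2 hFle)
      nlinarith
  · filter_upwards [tendsto_mul_log_natCast_atTop.eventually_gt_atTop 0] with n hn
    refine lt_of_le_of_lt ?_ ha
    rw [div_le_iff₀ hn]
    have h1 : optimalSize A n ≤ ⌊Real.exp (n * Real.log n / 2)⌋₊ := by
      classical exact Nat.findGreatest_le _
    have h2 : (optimalSize A n : ℝ) ≤ Real.exp (n * Real.log n / 2) :=
      (Nat.le_floor_iff (Real.exp_pos _).le).1 h1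
    rcases Nat.eq_zero_or_pos (optimalSize A n) with h0 | h0
    · rw [h0]; simp only [Nat.cast_zero, Real.log_zero]; positivity
    · have := Real.log_le_log (by exact_mod_cast h0) h2
      rw [Real.log_exp] at this
      linarith

lemma achievesRate_optimalSize {A : ℝ} (hA : 0 < A) {L : ℕ} (hL : 1 ≤ L) :
    AchievesRate (poissonChannel A) (optimalSize A) (fun n => L * poissonError A n)
      (poissonError A) (1 / 2) where
  codes n _ := by
    obtain ⟨u, D, h⟩ := existsDICode_optimalSize A n
    exact ⟨u, D, h.mono (poissonError_le_mul hL n)⟩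
  tendsto₁ := by simpa using (tendsto_poissonError hA).const_mul (L : ℝ)
  tendsto₂ := tendsto_poissonError hA
  rate := tendsto_rate_optimalSize hA

lemma rate_le_half {A : ℝ} (hA : 0 < A) {R : ℝ} (hR : IsAchievableRate (poissonChannel A) R) :
    R ≤ 1 / 2 := by
  obtain ⟨-, N, l₁, l₂, h⟩ := hR
  have hlim : Tendsto (fun n : ℕ => Real.log (√A + 1) / Real.log n + 1 / 2) atTop
      (𝓝 (1 / 2)) := by
    simpa only [zero_add] using
      (tendsto_log_natCast_atTop.const_div_atTop (Real.log (√A + 1))).add_const (1 / 2)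
  refine le_of_tendsto_of_tendsto h.rate hlim ?_
  filter_upwards [h.tendsto₁.eventually_lt_const (by norm_num : (0 : ℝ) < 1 / 16),
    h.tendsto₂.eventually_lt_const (by norm_num : (0 : ℝ) < 1 / 16), eventually_ge_atTop 1,
    tendsto_log_natCast_atTop.eventually_gt_atTop 0] with n h₁ h₂ hn hl
  have hn' : (1 : ℝ) ≤ n := by exact_mod_cast hn
  have hcard := card_le_of_existsDICode hA hn (h.codes n hn) h₁ h₂
  have hle : (N n : ℝ) ≤ ((√A + 1) * √n) ^ n := by
    refine hcard.trans (pow_le_pow_left₀ (by positivity) ?_ n)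
    have := Real.one_le_sqrt.2 hn'
    linarith
  have hlogA : 0 ≤ Real.log (√A + 1) := Real.log_nonneg (by linarith [Real.sqrt_nonneg A])
  have hlog : Real.log (N n) ≤ n * (Real.log (√A + 1) + Real.log n / 2) := by
    rcases Nat.eq_zero_or_pos (N n) with h0 | h0
    · rw [h0]; simp only [Nat.cast_zero, Real.log_zero]; positivity
    · have := Real.log_le_log (by exact_mod_cast h0) hle
      rwa [Real.log_pow, Real.log_mul (by positivity) (by positivity),
        Real.log_sqrt (by positivity)] at this
  rw [div_le_iff₀ (by positivity)]
  refine hlog.trans (le_of_eq ?_)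
  field_simp

end

theorem mainTheorem5 (A : ℝ) (hA : 0 < A) :
    -- existence, for every fixed number `L`
    (∀ L : ℕ, 1 ≤ L → ∃ N : ℕ → ℕ,
      AchievesRate (poissonChannel A) N
        (fun n => L * poissonError A n) (poissonError A) (1 / 2)) ∧
    -- the scaled, expurgated `L`-layer code with decoders of radius `A log n`: errors and size
    (∀ L : ℕ, 1 ≤ L → ∀ δ : ℝ, 0 < δ → δ < 1 →
      (∀ᶠ n : ℕ in atTop, ∀ B : PoissonCodebook A δ L n,
        IsDICode (poissonChannel A) (B.input A)
          (fun s : B.Message A => B.decoder (A * Real.log n) s.1)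
          (L * poissonError A n) (poissonError A n)) ∧
      ∃ K : ℝ, ∀ᶠ n : ℕ in atTop, ∃ B : PoissonCodebook A δ L n,
        n * Real.log n / 2 * (∑ ℓ ∈ Finset.Icc 1 L, (1 - δ) / 2 ^ ℓ)
          - K * (n * Real.log (Real.log n)) ≤ Real.log (Nat.card (B.Message A))) ∧
    -- hence, with suitable `L` and `δ`, this code comes arbitrarily close to the rate `1/2`
    (∀ ε : ℝ, 0 < ε → ∃ (L : ℕ) (δ : ℝ), 1 ≤ L ∧ 0 < δ ∧ δ < 1 ∧
      ∀ᶠ n : ℕ in atTop, ∃ B : PoissonCodebook A δ L n,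
        1 / 2 - ε ≤ Real.log (Nat.card (B.Message A)) / (n * Real.log n)) ∧
    -- the capacity
    HasDICapacity (poissonChannel A) (1 / 2) := by
  refine ⟨fun L hL => ⟨_, achievesRate_optimalSize hA hL⟩, fun L hL δ hδ0 hδ1 => ⟨?_, 2 * L,
    eventually_exists_large_codebook hA hδ0 hδ1 hL⟩, fun ε hε => exists_codebook_rate_ge hA hε,
    ⟨⟨by norm_num, _, _, _, achievesRate_optimalSize hA le_rfl⟩, fun R hR => rate_le_half hA hR⟩⟩
  filter_upwards [eventually_isDICode hA L hδ1] with n hn B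
  exact (hn B).mono (poissonError_le_mul hL n)
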